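/- Let $X$ be a finite quandle with operation $\vartriangleleft$ (with $x\mapsto x\vartriangleleft y$ bijective, $(x\vartriangleleft y)\vartriangleleft z=(x\vartriangleleft z)\vartriangleleft(y\vartriangleleft z)$ and $x\vartriangleleft x=x$), and suppose that $X$ is connected, i.e. any element can be carried to any other one by finitely many operations $a\mapsto a\vartriangleleft^{\pm1}x$ with $x\in X$. Let $A$ be an abelian group, written multiplicatively, and let $\phi\colon X^3\to A$ be a quandle $3$-cocycle: $\phi(x,y,z)=1$ if $x=y$ or $y=z$, and for all $a,x,y,z\in X$ $$\frac{\phi(a\vartriangleleft x,y,z)}{\phi(a,y,z)}\cdot\frac{\phi(a,x,z)}{\phi(a\vartriangleleft y,x\vartriangleleft y,z)}\cdot\frac{\phi(a\vartriangleleft z,x\vartriangleleft z,y\vartriangleleft z)}{\phi(a,x,y)}=1 .$$ Let $L$ be an oriented link in $\mathbb{R}^3$ and let $D$ be a diagram of $L$, i.e. a regular projection to the plane of a link equivalent to $L$. The arcs of $D$ are the connected components of its curves after cutting them at the under-crossings, the regions are the connected components of the complement of $D$, and the normal vector of $D$ points to the left of the direction of travel. At a point $p$ of $D$ which is not a crossing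 let $c_p$ be the arc through $p$, and let $r^{\mathrm{ini}}_p$, $r^{\mathrm{ter}}_p$ be the regions at $p$ from which and into which the normal vector points. At a crossing $c$ let $o_c$ be the over-arc, let $u^{\mathrm{ini}}_c$, $u^{\mathrm{ter}}_c$ be the under-arcs from which and to which the normal vector of $o_c$ points, let $r^{\mathrm{ini}}_c$ be the region at $c$ which lies on the initial side of both strands, and let $\epsilon_c=\pm1$ be the sign of $c$. An $X$-shadow colouring $C$ of $D$ assigns an element of $X$ to every arc and to every region so that $C(u^{\mathrm{ini}}_c)\vartriangleleft C(o_c)=C(u^{\mathrm{ter}}_c)$ at every crossing $c$ and $C(r^{\mathrm{ini}}_p)\vartriangleleft C(c_p)=C(r^{\mathrm{ter}}_p)$ at every point $p$ of $D$ which is not a crossing. Its whole weight is $$W(C)=\prod_{c}\phi\bigl(C(r^{\mathrm{ini}}_c),C(u^{\mathrm{ini}}_c),C(o_c)\bigr)^{\epsilon_c}\in A,$$ the product being over all crossings. The shadow cocycle invariant is $\Phi_\phi(L)=\sum_C W(C)\in\mathbb{Z}[A]$, the sum being over all $X$-shadow colourings of $D$. Satoh's based shadow cocycle invariant is $\Phi^\ast_\phi(L)=\sum_C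 W(C)\in\mathbb{Z}[A]$, the sum being over those $X$-shadow colourings for which $C(r^{\mathrm{ini}}_p)=C(r^{\mathrm{ter}}_p)=C(c_p)$, where $p$ is a chosen point of $D$ which is not a crossing. Then, for every link $L$, every diagram $D$ of $L$ and every chosen point $p$ of $D$, there are only finitely many $X$-shadow colourings of $D$, and the invariants computed from $D$ and $p$ satisfy $$\Phi_\phi(L)=|X|\cdot\Phi^\ast_\phi(L).$$ -/

import Mathlib

open Filter Topology
open scoped ContDiff Quandles

noncomputable section

/-! ## Quandles and quandle cocycles

Mathlib writes the quandle operation as a left action: `b ◃ a` is the result of `b` acting on `a`,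
that is, `a ⊲ b` in the right-handed notation used for colourings of diagrams; `b ◃⁻¹ a` is the
inverse operation. -/

/-- `b` is obtained from `a` by one operation `a ⊲ x` or `a ⊲⁻¹ x`. -/
def QuandleStep {X : Type*} [Quandle X] (a b : X) : Prop :=
  ∃ x : X, b = x ◃ a ∨ b = x ◃⁻¹ a

/-- A quandle is connected if any element is reached from any other one by finitely many operations
`a ↦ a ⊲ x` and `a ↦ a ⊲⁻¹ x`. -/
def QuandleConnected (X : Type*) [Quandle X] : Prop :=
  ∀ a b : X, Relation.ReflTransGen QuandleStep a b

/-- `(x₀, …, xₙ) ↦ (x₀, …, xᵢ₋₁, xᵢ₊₁, …, xₙ)`. -/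
def rackFaceZero {X : Type*} {n : ℕ} (i : Fin (n + 1)) (x : Fin (n + 1) → X) : Fin n → X :=
  fun j => x (i.succAbove j)

/-- `(x₀, …, xₙ) ↦ (x₀ ⊲ xᵢ, …, xᵢ₋₁ ⊲ xᵢ, xᵢ₊₁, …, xₙ)`. -/
def rackFaceOne {X : Type*} [Quandle X] {n : ℕ} (i : Fin (n + 1)) (x : Fin (n + 1) → X) :
    Fin n → X :=
  fun j => if j.castSucc < i then x i ◃ x (i.succAbove j) else x (i.succAbove j)

/-- The coboundary of a rack `n`-cochain (`n ≥ 1`) with values in an abelian group written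
multiplicatively: the value of the cochain on the boundary
`∂(x₀, …, xₙ) = ∑ᵢ (-1)^(n - i) ((x₀ ⊲ xᵢ, …, xᵢ₋₁ ⊲ xᵢ, xᵢ₊₁, …) - (x₀, …, xᵢ₋₁, xᵢ₊₁, …))`. -/
def rackCoboundary {X : Type*} [Quandle X] {A : Type*} [CommGroup A] {n : ℕ}
    (φ : (Fin n → X) → A) (x : Fin (n + 1) → X) : A :=
  ∏ i : Fin (n + 1), (φ (rackFaceOne i x) / φ (rackFaceZero i x)) ^ ((-1 : ℤ) ^ (n - (i : ℕ)))

/-- A quandle `n`-cocycle (`n ≥ 1`): a rack cochain with trivial coboundary which is trivial on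
every tuple with two equal consecutive entries. -/
structure IsQuandleCocycle {X : Type*} [Quandle X] {A : Type*} [CommGroup A] {n : ℕ}
    (φ : (Fin n → X) → A) : Prop where
  coboundary_eq_one : ∀ x : Fin (n + 1) → X, rackCoboundary φ x = 1
  degenerate : ∀ (x : Fin n → X) (j k : Fin n), (j : ℕ) + 1 = k → x j = x k → φ x = 1

/-! ## Links and their diagrams -/

/-- An oriented (smooth, parametrised) link in `ℝ³ = ℂ × ℝ`: finitely many smoothly immersed
circles which are jointly embedded. The coordinate in `ℝ` is the height over the plane `ℂ`. -/
structure OrientedLink where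
  /-- the number of components -/
  n : ℕ
  curve : Fin n → UnitAddCircle → ℂ × ℝ
  smooth : ∀ i, ContDiff ℝ ∞ (fun t : ℝ => curve i (t : UnitAddCircle))
  immersed : ∀ i (t : ℝ), deriv (fun t : ℝ => curve i (t : UnitAddCircle)) t ≠ 0
  embedded : ∀ i j s t, curve i s = curve j t → i = j ∧ s = t

namespace OrientedLink

/-- The parameter space of a link: a point of the `i`-th circle. -/
abbrev Point (K : OrientedLink) : Type := Fin K.n × UnitAddCircle

/-- The projection of a link to the plane. -/
def proj (K : OrientedLink) (q : K.Point) : ℂ := (K.curve q.1 q.2).1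

/-- The height of a point of the link over the plane. -/
def height (K : OrientedLink) (q : K.Point) : ℝ := (K.curve q.1 q.2).2

/-- The point reached from `q` when the parameter of its circle is increased by `s`. -/
def shift (K : OrientedLink) (q : K.Point) (s : ℝ) : K.Point := (q.1, q.2 + (s : UnitAddCircle))

/-- The velocity of the projected link. -/
def velocity (K : OrientedLink) (q : K.Point) : ℂ := deriv (fun s : ℝ => K.proj (K.shift q s)) 0

/-- The normal vector of the projected link: the velocity turned to the left. -/
def normal (K : OrientedLink) (q : K.Point) : ℂ := Complex.I * K.velocity q

/-- The crossings of the projection: pairs (over-point, under-point) over the same point of the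
plane. -/
def crossings (K : OrientedLink) : Set (K.Point × K.Point) :=
  {c | K.proj c.1 = K.proj c.2 ∧ K.height c.2 < K.height c.1}

/-- The projection is regular: a plane immersion all of whose multiple points are transverse double
points, finite in number. -/
structure IsRegular (K : OrientedLink) : Prop where
  velocity_ne_zero : ∀ q, K.velocity q ≠ 0
  no_triple : ∀ q₁ q₂ q₃, K.proj q₁ = K.proj q₂ → K.proj q₂ = K.proj q₃ →
    q₁ = q₂ ∨ q₂ = q₃ ∨ q₁ = q₃
  transverse : ∀ q₁ q₂, q₁ ≠ q₂ → K.proj q₁ = K.proj q₂ →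
    LinearIndependent ℝ ![K.velocity q₁, K.velocity q₂]
  finite_crossings : K.crossings.Finite

/-- Equivalence of oriented links: an isotopy of the ambient space takes the one to the other, up to
the order of the components and orientation-preserving changes of the parameters. -/
def AmbientIsotopic (L K : OrientedLink) : Prop :=
  ∃ H : unitInterval → (ℂ × ℝ ≃ₜ ℂ × ℝ),
    Continuous (fun p : unitInterval × (ℂ × ℝ) => H p.1 p.2) ∧
    H 0 = Homeomorph.refl _ ∧
    ∃ (e : Fin L.n ≃ Fin K.n) (ρ : Fin L.n → ℝ → ℝ),
      (∀ i, Continuous (ρ i) ∧ StrictMono (ρ i) ∧ ∀ t, ρ i (t + 1) = ρ i t + 1) ∧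
      ∀ i (t : ℝ), H 1 (L.curve i (t : UnitAddCircle)) = K.curve (e i) (ρ i t : UnitAddCircle)

/-- A diagram of the link `L`: a link which is equivalent to `L` and has a regular projection. -/
structure Diagram (L : OrientedLink) where
  link : OrientedLink
  isotopic : L.AmbientIsotopic link
  regular : link.IsRegular

namespace Diagram

variable {L : OrientedLink} (D : L.Diagram)

/-- Parameter points of a diagram. -/
abbrev Point : Type := D.link.Point

/-- `q` lies under another strand of the diagram. -/
def IsUnder (q : D.Point) : Prop := ∃ o, (o, q) ∈ D.link.crossings

/-- `q` is not a crossing point (neither over nor under). -/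
def IsSimple (q : D.Point) : Prop := ∀ q', D.link.proj q' = D.link.proj q → q' = q

/-- The curves of the diagram, cut at the under-points. -/
abbrev CutCurve : Type := {q : D.Point // ¬ D.IsUnder q}

/-- The components (arcs) of the diagram: the connected components of the curves after cutting them
at the under-points. -/
abbrev Arc : Type := ConnectedComponents D.CutCurve

/-- The exterior of the diagram in the plane. -/
abbrev Exterior : Type := {z : ℂ // z ∉ Set.range D.link.proj}

/-- The regions of the diagram: the connected components of its exterior. -/
abbrev Region : Type := ConnectedComponents D.Exterior

/-- The points of the diagram which are not crossing points. -/
abbrev SimplePoint : Type := {q : D.Point // D.IsSimple q}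

/-- The crossings of the diagram. -/
abbrev Crossing : Type := D.link.crossings

variable {D}

theorem SimplePoint.not_isUnder (p : D.SimplePoint) : ¬ D.IsUnder p.1 := by
  rintro ⟨o, ho, hlt⟩
  have := p.2 o ho
  subst this
  exact lt_irrefl _ hlt

theorem Crossing.over_not_isUnder (c : D.Crossing) : ¬ D.IsUnder c.1.1 := by
  rintro ⟨o, ho, hlt⟩
  obtain ⟨h₁, h₂⟩ := c.2
  rcases D.regular.no_triple _ _ _ ho h₁ with h | h | h
  · rw [h] at hlt; exact lt_irrefl _ hlt
  · change c.1.1 = c.1.2 at h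
    rw [h] at h₂; exact lt_irrefl _ h₂
  · rw [h] at hlt; exact lt_irrefl _ (hlt.trans h₂)

theorem continuous_proj (K : OrientedLink) : Continuous K.proj := by
  refine continuous_prod_of_discrete_left.2 fun i => ?_
  refine (QuotientAddGroup.isQuotientMap_mk (G := ℝ)
    (N := AddSubgroup.zmultiples (1 : ℝ))).continuous_iff.2 ?_
  exact continuous_fst.comp (K.smooth i).continuous

instance : Nonempty D.Region := by
  have h : Set.range D.link.proj ≠ Set.univ := fun h =>
    noncompact_univ ℂ (h ▸ isCompact_range (continuous_proj D.link))
  obtain ⟨z, hz⟩ := (Set.ne_univ_iff_exists_notMem _).1 h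
  exact ⟨ConnectedComponents.mk ⟨z, hz⟩⟩

/-- The arc which contains a given simple point. -/
def SimplePoint.arc (p : D.SimplePoint) : D.Arc := ConnectedComponents.mk ⟨p.1, p.not_isUnder⟩

/-- The over-arc of a crossing. -/
def Crossing.overArc (c : D.Crossing) : D.Arc := ConnectedComponents.mk ⟨c.1.1, c.over_not_isUnder⟩

variable (D)

/-- All points `z + s v` with `s > 0` small lie in the region `r`. -/
def PointsInto (z v : ℂ) (r : D.Region) : Prop :=
  ∀ᶠ s : ℝ in 𝓝[>] 0, ∃ h : z + s * v ∉ Set.range D.link.proj,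
    ConnectedComponents.mk (⟨z + s * v, h⟩ : D.Exterior) = r

/-- All points reached from `q` by changing the parameter by `d s` with `s > 0` small lie in the
arc `a`. -/
def RunsInto (q : D.Point) (d : ℝ) (a : D.Arc) : Prop :=
  ∀ᶠ s : ℝ in 𝓝[>] 0, ∃ h : ¬ D.IsUnder (D.link.shift q (d * s)),
    ConnectedComponents.mk (⟨D.link.shift q (d * s), h⟩ : D.CutCurve) = a

variable {D}

/-- The initial region of a simple point: the one from which the normal vector points to the
curve. (Here and below, `Classical.epsilon` picks the unique object with the stated property.) -/
def SimplePoint.iniRegion (p : D.SimplePoint) : D.Region :=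
  Classical.epsilon (D.PointsInto (D.link.proj p.1) (- D.link.normal p.1))

/-- The terminal region of a simple point: the one into which the normal vector points. -/
def SimplePoint.terRegion (p : D.SimplePoint) : D.Region :=
  Classical.epsilon (D.PointsInto (D.link.proj p.1) (D.link.normal p.1))

/-- The initial region of a crossing: of the four regions around the crossing, the one which lies on
the initial side of both strands. -/
def Crossing.iniRegion (c : D.Crossing) : D.Region :=
  Classical.epsilon fun r => ∀ v : ℂ,
    inner ℝ v (D.link.normal c.1.1) < 0 → inner ℝ v (D.link.normal c.1.2) < 0 →
      D.PointsInto (D.link.proj c.1.1) v r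

/-- The sign of a crossing: `1` if the velocities of the over- and the under-strand form a
positively oriented basis of the plane, and `-1` otherwise. -/
def Crossing.sign (c : D.Crossing) : ℤ :=
  if 0 < inner ℝ (D.link.normal c.1.1) (D.link.velocity c.1.2) then 1 else -1

/-- The initial under-arc of a crossing: the normal vector of the over-arc points away from it. If
the sign is positive, the under-strand runs in the direction of this normal vector, and the initial
under-arc is the one before the crossing; otherwise it is the one after it. -/
def Crossing.iniArc (c : D.Crossing) : D.Arc :=
  @Classical.epsilon _ ⟨c.overArc⟩ (D.RunsInto c.1.2 (-(c.sign : ℝ)))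

/-- The terminal under-arc of a crossing: the normal vector of the over-arc points to it. -/
def Crossing.terArc (c : D.Crossing) : D.Arc :=
  @Classical.epsilon _ ⟨c.overArc⟩ (D.RunsInto c.1.2 (c.sign : ℝ))

variable (D)

/-! ## Shadow colourings and the state sums -/

/-- An `X`-shadow colouring of a diagram: colours of the arcs and shadow colours of the regions with
`C(u_ini) ⊲ C(o) = C(u_ter)` at every crossing and `C'(r_ini) ⊲ C(c) = C'(r_ter)` at every point
which is not a crossing. -/
structure ShadowColouring (X : Type*) [Quandle X] where
  colour : D.Arc → X
  shadow : D.Region → X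
  colour_ter : ∀ c : D.Crossing, colour c.overArc ◃ colour c.iniArc = colour c.terArc
  shadow_ter : ∀ p : D.SimplePoint, colour p.arc ◃ shadow p.iniRegion = shadow p.terRegion

variable {D} {X : Type*} [Quandle X] {A : Type*} [CommGroup A]

/-- The Boltzmann weight of a crossing. -/
def ShadowColouring.weight (C : D.ShadowColouring X) (φ : (Fin 3 → X) → A) (c : D.Crossing) : A :=
  φ ![C.shadow c.iniRegion, C.colour c.iniArc, C.colour c.overArc] ^ c.sign

/-- The whole weight of a shadow colouring: the product of the weights of the finitely many
crossings. -/
def ShadowColouring.wholeWeight (C : D.ShadowColouring X) (φ : (Fin 3 → X) → A) : A :=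
  ∏ᶠ c : D.Crossing, C.weight φ c

/-- A shadow colouring is allowed at the chosen point `p` if the regions on both sides of `p` have
the colour of the arc through `p`. -/
def ShadowColouring.IsAllowed (C : D.ShadowColouring X) (p : D.SimplePoint) : Prop :=
  C.shadow p.iniRegion = C.colour p.arc ∧ C.shadow p.terRegion = C.colour p.arc

variable (D)

/-- The shadow cocycle invariant: the sum, in the group ring `ℤ[A]`, of the whole weights of all
`X`-shadow colourings. -/
def shadowInvariant (φ : (Fin 3 → X) → A) : MonoidAlgebra ℤ A :=
  ∑ᶠ C : D.ShadowColouring X, MonoidAlgebra.of ℤ A (C.wholeWeight φ)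

/-- The based shadow cocycle invariant: the sum, in the group ring `ℤ[A]`, of the whole weights of
the `X`-shadow colourings which are allowed at the chosen point `p`. -/
def basedShadowInvariant (φ : (Fin 3 → X) → A) (p : D.SimplePoint) : MonoidAlgebra ℤ A :=
  ∑ᶠ C : {C : D.ShadowColouring X // C.IsAllowed p}, MonoidAlgebra.of ℤ A (C.1.wholeWeight φ)

end Diagram

end OrientedLink

end

/-! Fix the colours of the arcs. Crossing the diagram at a point of an arc of colour `x` changes the
shadow by the bijection `x ◃ ·`. Hence one region colour determines all others. Conversely any
region colour extends: around a crossing the four jumps are compatible, by the rule for arc colours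
and self-distributivity, and the plane is simply connected, so there is no global obstruction. Thus
shadow colourings correspond to pairs (arc colouring, colour of one region). Since `x ◃ x = x`, each
arc colouring has exactly one shadow colouring allowed at `p`. The theorem follows once the whole
weight is known to depend on the arc colours only.

For this, let `Y` and `C` be shadow colourings with the same arc colours. Then `r ↦ Y r ◃ C r` is
again a shadow of these arc colours. The cocycle condition for `(C r, Y r, u, o)` at a crossing,
with `r` its initial region, `u` the initial under-arc colour and `o` the over-arc colour, expresses
the change of the weight by values of `φ (C r, Y r, a)`, with `r` the initial region and `a` the arc
colour at points of the diagram near the crossing. The change is the ratio of the values before and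
after the crossing on the over-strand, times the same ratio on the under-strand. Along the closed
curves these ratios multiply to `1` (`prod_left_div_right`), so the weight is unchanged
(`wholeWeight_shadowAct`). As `Y` can have any colour at a given region, connectedness of `X` joins
any two shadows of the same arc colours by such changes and their inverses.

The geometric input is a chart at each simple point and each crossing in which the diagram is one or
two coordinate axes. The charts identify the arcs and regions chosen by `Classical.epsilon`. They
also supply the local solutions glued in `exists_isJumpSection` and the uniqueness statement
`IsJumpSection.eq_of_isOpen`. -/

/-! ## Planar analysis -/

/-- The oriented area of the parallelogram spanned by two plane vectors. -/
def planeCross (a b : ℂ) : ℝ := a.re * b.im - a.im * b.re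

theorem inner_I_mul_eq_planeCross (a b : ℂ) : inner ℝ (Complex.I * a) b = planeCross a b := by
  simp [planeCross, Complex.inner]; ring

theorem planeCross_I_mul_self (a : ℂ) : planeCross a (Complex.I * a) = ‖a‖ ^ 2 := by
  rw [← Complex.normSq_eq_norm_sq, Complex.normSq_apply]
  simp [planeCross]

theorem planeCross_I_mul_self_left (a : ℂ) : planeCross (Complex.I * a) a = -‖a‖ ^ 2 := by
  rw [← Complex.normSq_eq_norm_sq, Complex.normSq_apply]
  simp [planeCross]; ring

theorem planeCross_neg_right (a b : ℂ) : planeCross a (-b) = -planeCross a b := by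
  simp [planeCross]; ring

theorem planeCross_neg_left (a b : ℂ) : planeCross (-a) b = -planeCross a b := by
  simp [planeCross]; ring

theorem planeCross_ne_zero_of_linearIndependent {a b : ℂ}
    (h : LinearIndependent ℝ ![a, b]) : planeCross a b ≠ 0 := by
  intro h0
  rw [LinearIndependent.pair_iff] at h
  have key : a.re * b.im - a.im * b.re = 0 := h0
  have h1 := h b.im (-a.im) (by
    apply Complex.ext
    · simp; linarith
    · simp; ring)
  have h2 := h b.re (-a.re) (by
    apply Complex.ext
    · simp; ring
    · simp; linarith)
  have hb : b = 0 := Complex.ext h2.1 h1.1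
  have := h 0 1 (by simp [hb])
  exact one_ne_zero this.2

/-- The linear equivalence `(s, t) ↦ s a + t b` for a basis `a, b` of the plane. -/
noncomputable def planeBasisEquiv (a b : ℂ) (h : planeCross a b ≠ 0) : (ℝ × ℝ) ≃L[ℝ] ℂ :=
  LinearEquiv.toContinuousLinearEquiv
    { toFun := fun x => x.1 • a + x.2 • b
      invFun := fun v => (planeCross v b / planeCross a b, planeCross a v / planeCross a b)
      map_add' := fun x y => by simp only [Prod.fst_add, Prod.snd_add, add_smul]; abel
      map_smul' := fun c x => by simp [mul_smul, smul_add]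
      left_inv := fun x => by
        apply Prod.ext
        · rw [div_eq_iff h]; simp [planeCross]; ring
        · rw [div_eq_iff h]; simp [planeCross]; ring
      right_inv := fun v => by
        have h' : a.re * b.im - a.im * b.re ≠ 0 := h
        apply Complex.ext
        · simp only [planeCross, Complex.add_re, Complex.smul_re, smul_eq_mul]
          rw [div_mul_eq_mul_div, div_mul_eq_mul_div, ← add_div, div_eq_iff h']; ring
        · simp only [planeCross, Complex.add_im, Complex.smul_im, smul_eq_mul]
          rw [div_mul_eq_mul_div, div_mul_eq_mul_div, ← add_div, div_eq_iff h']; ring }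

theorem planeBasisEquiv_apply (a b : ℂ) (h : planeCross a b ≠ 0) (x : ℝ × ℝ) :
    planeBasisEquiv a b h x = x.1 • a + x.2 • b := rfl

/-- A chart of the plane whose coordinate lines are translates of the curves `γ₁` and `γ₂`. -/
structure IsCurveChart (γ₁ γ₂ : ℝ → ℂ) (e : OpenPartialHomeomorph (ℝ × ℝ) ℂ) : Prop where
  contDiff_fst : ContDiff ℝ 1 γ₁
  contDiff_snd : ContDiff ℝ 1 γ₂
  zero_mem : ((0 : ℝ), (0 : ℝ)) ∈ e.source
  apply_eq : ∀ x, e x = γ₁ x.1 + γ₂ x.2 - γ₁ 0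
  cross_pos : ∀ x ∈ e.source, 0 < planeCross (deriv γ₁ x.1) (deriv γ₂ x.2)

theorem hasFDerivAt_add_curves {γ₁ γ₂ : ℝ → ℂ} (h₁ : ContDiff ℝ 1 γ₁) (h₂ : ContDiff ℝ 1 γ₂)
    (w : ℂ) (x : ℝ × ℝ) (h : planeCross (deriv γ₁ x.1) (deriv γ₂ x.2) ≠ 0) :
    HasFDerivAt (fun x : ℝ × ℝ => γ₁ x.1 + γ₂ x.2 - w)
      (planeBasisEquiv _ _ h : ℝ × ℝ →L[ℝ] ℂ) x := by
  have d₁ := ((h₁.differentiable one_ne_zero x.1).hasDerivAt.hasFDerivAt).comp x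
    (hasFDerivAt_fst (𝕜 := ℝ) (E := ℝ) (F := ℝ) (p := x))
  have d₂ := ((h₂.differentiable one_ne_zero x.2).hasDerivAt.hasFDerivAt).comp x
    (hasFDerivAt_snd (𝕜 := ℝ) (E := ℝ) (F := ℝ) (p := x))
  refine ((d₁.add d₂).sub_const w).congr_fderiv ?_
  ext <;> simp [planeBasisEquiv_apply]

/-- The two velocities are the columns of the derivative of `(s, t) ↦ γ₁ s + γ₂ t - γ₁ 0`, so the
inverse function theorem applies at the origin. The chart is then cut down to the open set where the
velocities are positively oriented. -/
theorem exists_isCurveChart {γ₁ γ₂ : ℝ → ℂ} (h₁ : ContDiff ℝ 1 γ₁) (h₂ : ContDiff ℝ 1 γ₂)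
    (h : 0 < planeCross (deriv γ₁ 0) (deriv γ₂ 0)) : ∃ e, IsCurveChart γ₁ γ₂ e := by
  have hc : ContDiff ℝ 1 (fun x : ℝ × ℝ => γ₁ x.1 + γ₂ x.2 - γ₁ 0) :=
    ((h₁.comp contDiff_fst).add (h₂.comp contDiff_snd)).sub contDiff_const
  have hd := hasFDerivAt_add_curves h₁ h₂ (γ₁ 0) (0, 0) h.ne'
  let e := hc.contDiffAt.toOpenPartialHomeomorph _ hd one_ne_zero
  have hcont : Continuous fun x : ℝ × ℝ => planeCross (deriv γ₁ x.1) (deriv γ₂ x.2) := by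
    have c₁ := (h₁.continuous_deriv le_rfl).comp continuous_fst (Y := ℝ) (X := ℝ × ℝ)
    have c₂ := (h₂.continuous_deriv le_rfl).comp continuous_snd (Y := ℝ) (X := ℝ × ℝ)
    exact ((Complex.continuous_re.comp c₁).mul (Complex.continuous_im.comp c₂)).sub
      ((Complex.continuous_im.comp c₁).mul (Complex.continuous_re.comp c₂))
  have ho : IsOpen {x : ℝ × ℝ | 0 < planeCross (deriv γ₁ x.1) (deriv γ₂ x.2)} :=
    isOpen_lt continuous_const hcont
  refine ⟨e.restrOpen _ ho, h₁, h₂, ⟨?_, h⟩, fun x => rfl, fun x hx => ?_⟩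
  · exact hc.contDiffAt.mem_toOpenPartialHomeomorph_source hd one_ne_zero
  · exact hx.2

theorem HasDerivAt.eventually_lt_of_pos {f : ℝ → ℝ} {f' : ℝ} (hf : HasDerivAt f f' 0)
    (h : 0 < f') : ∀ᶠ τ in 𝓝[>] (0 : ℝ), f 0 < f τ := by
  have := (hasDerivAt_iff_tendsto_slope.1 hf).mono_left
    (nhdsWithin_mono 0 (fun x (hx : (0 : ℝ) < x) => hx.ne'))
  filter_upwards [this.eventually (eventually_gt_nhds h), self_mem_nhdsWithin] with τ h1 h2
  have h2 : (0 : ℝ) < τ := h2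
  rw [slope_def_field, sub_zero, div_pos_iff_of_pos_right h2] at h1
  linarith

theorem HasDerivAt.eventually_gt_of_neg {f : ℝ → ℝ} {f' : ℝ} (hf : HasDerivAt f f' 0)
    (h : f' < 0) : ∀ᶠ τ in 𝓝[>] (0 : ℝ), f τ < f 0 := by
  filter_upwards [hf.neg.eventually_lt_of_pos (neg_pos.2 h)] with τ hτ
  simpa using hτ

/-- The derivative of the inverse chart writes `v` in the basis of the two velocities; the quotients
are Cramer's rule. -/
theorem IsCurveChart.hasDerivAt_symm {γ₁ γ₂ : ℝ → ℂ} {e : OpenPartialHomeomorph (ℝ × ℝ) ℂ}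
    (he : IsCurveChart γ₁ γ₂ e) {x : ℝ × ℝ} (hx : x ∈ e.source) (v : ℂ) :
    HasDerivAt (fun τ : ℝ => e.symm (e x + τ * v))
      (planeCross v (deriv γ₂ x.2) / planeCross (deriv γ₁ x.1) (deriv γ₂ x.2),
        planeCross (deriv γ₁ x.1) v / planeCross (deriv γ₁ x.1) (deriv γ₂ x.2)) 0 := by
  have hd := hasFDerivAt_add_curves he.contDiff_fst he.contDiff_snd (γ₁ 0) x
    (he.cross_pos x hx).ne'
  have hfun : (e : ℝ × ℝ → ℂ) = fun x : ℝ × ℝ => γ₁ x.1 + γ₂ x.2 - γ₁ 0 := funext he.apply_eq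
  have hs := e.hasFDerivAt_symm (a := e x) (e.map_source hx)
    (f' := planeBasisEquiv _ _ (he.cross_pos x hx).ne') (by rw [e.left_inv hx, hfun]; exact hd)
  have hl : HasDerivAt (fun τ : ℝ => e x + τ * v) v 0 := by
    simpa using ((Complex.ofRealCLM.hasDerivAt (x := 0)).mul_const v).const_add (e x)
  have hs' : HasFDerivAt e.symm
      ((planeBasisEquiv _ _ (he.cross_pos x hx).ne').symm : ℂ →L[ℝ] ℝ × ℝ)
      (e x + ((0 : ℝ) : ℂ) * v) := by simpa using hs
  exact hs'.comp_hasDerivAt (0 : ℝ) hl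

/-- To first order a short ray from `e x` moves each chart coordinate according to the sign of a
cross product. This translates normal vectors into sides of the coordinate axes. -/
theorem IsCurveChart.eventually_direction {γ₁ γ₂ : ℝ → ℂ} {e : OpenPartialHomeomorph (ℝ × ℝ) ℂ}
    (he : IsCurveChart γ₁ γ₂ e) {x : ℝ × ℝ} (hx : x ∈ e.source) {N : Set (ℝ × ℝ)} (hN : N ∈ 𝓝 x)
    (v : ℂ) : ∀ᶠ τ : ℝ in 𝓝[>] 0, ∃ y ∈ N, e y = e x + τ * v ∧
      (0 < planeCross v (deriv γ₂ x.2) → x.1 < y.1) ∧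
      (planeCross v (deriv γ₂ x.2) < 0 → y.1 < x.1) ∧
      (0 < planeCross (deriv γ₁ x.1) v → x.2 < y.2) ∧
      (planeCross (deriv γ₁ x.1) v < 0 → y.2 < x.2) := by
  have hd := he.hasDerivAt_symm hx v
  have hpos := he.cross_pos x hx
  have d₁ := ((ContinuousLinearMap.fst ℝ ℝ ℝ).hasFDerivAt).comp_hasDerivAt (0 : ℝ) hd
  have d₂ := ((ContinuousLinearMap.snd ℝ ℝ ℝ).hasFDerivAt).comp_hasDerivAt (0 : ℝ) hd
  have h0 : e.symm (e x + ((0 : ℝ) : ℂ) * v) = x := by simp [e.left_inv hx]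
  have hcont : ContinuousAt (fun τ : ℝ => e x + τ * v) 0 := by fun_prop
  have ht : ∀ᶠ τ : ℝ in 𝓝[>] 0, e x + τ * v ∈ e.target :=
    nhdsWithin_le_nhds (hcont.eventually (by simpa using e.open_target.mem_nhds (e.map_source hx)))
  have hn : ∀ᶠ τ : ℝ in 𝓝[>] 0, e.symm (e x + τ * v) ∈ N :=
    nhdsWithin_le_nhds (hd.continuousAt.eventually (by simpa [e.left_inv hx] using hN))
  have imp : ∀ {P : Prop} {Q : ℝ → Prop}, (P → ∀ᶠ τ : ℝ in 𝓝[>] 0, Q τ) →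
      ∀ᶠ τ : ℝ in 𝓝[>] 0, P → Q τ := fun {P Q} h => by
    by_cases hP : P
    · exact (h hP).mono fun τ hτ _ => hτ
    · exact Eventually.of_forall fun τ hP' => (hP hP').elim
  filter_upwards [ht, hn,
    imp fun h => d₁.eventually_lt_of_pos (div_pos h hpos),
    imp fun h => d₁.eventually_gt_of_neg (div_neg_of_neg_of_pos h hpos),
    imp fun h => d₂.eventually_lt_of_pos (div_pos h hpos),
    imp fun h => d₂.eventually_gt_of_neg (div_neg_of_neg_of_pos h hpos)]
    with τ h1 h2 h3 h4 h5 h6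
  simp only [Function.comp_apply, h0, ContinuousLinearMap.coe_fst', ContinuousLinearMap.coe_snd']
    at h3 h4 h5 h6
  exact ⟨_, h2, e.right_inv h1, h3, h4, h5, h6⟩

/-! ## Locally constant functions -/

theorem IsPreconnected.eq_of_eventually_eq {α T : Type*} [TopologicalSpace α] {S : Set α}
    (hS : IsPreconnected S) {f : α → T} (h : ∀ x ∈ S, ∀ᶠ y in 𝓝[S] x, f y = f x)
    {x y : α} (hx : x ∈ S) (hy : y ∈ S) : f x = f y := by
  let _ : TopologicalSpace T := ⊥
  have : DiscreteTopology T := ⟨rfl⟩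
  refine hS.constant (fun x hx => ?_) hx hy
  exact tendsto_nhds_of_eventually_eq (h x hx)

/-- A multiplicative Čech `1`-cocycle of constants on an open cover of a simply connected space is a
coboundary of locally constant functions. -/
theorem exists_locally_constant_trivialization {B ι G : Type*} [TopologicalSpace B]
    [SimplyConnectedSpace B] [LocallyPathConnectedSpace B] [Group G]
    (U : ι → Set B) (hU : ∀ i, IsOpen (U i)) (idx : B → ι) (hidx : ∀ x, x ∈ U (idx x))
    (h : ι → ι → G)
    (hcomp : ∀ i j k, ∀ x ∈ U i ∩ U j ∩ U k, h i j * h j k = h i k) :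
    ∃ a : B → G, ∀ i, ∀ x ∈ U i, ∀ᶠ y in 𝓝 x, h i (idx y) * a y = h i (idx x) * a x := by
  let _ : TopologicalSpace G := ⊥
  have : DiscreteTopology G := ⟨rfl⟩
  -- The constants are the transition functions of a bundle with discrete fibre, that is, of a
  -- covering of `B`. Since `B` is simply connected, the identity lifts to a global section, and `a`
  -- is its fibre coordinate.
  let Z : FiberBundleCore ι B G :=
    { baseSet := U
      isOpen_baseSet := hU
      indexAt := idx
      mem_baseSet_at := hidx
      coordChange := fun i j _ v => h j i * v
      coordChange_self := fun i x hx v => by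
        have : h i i = 1 := by simpa using hcomp i i i x ⟨⟨hx, hx⟩, hx⟩
        rw [this, one_mul]
      continuousOn_coordChange := fun i j =>
        (continuous_of_discreteTopology (f := fun v : G => h j i * v)).comp_continuousOn
          continuousOn_snd
      coordChange_comp := fun i j k x hx v => by
        rw [← mul_assoc, hcomp k j i x ⟨⟨hx.2, hx.1.2⟩, hx.1.1⟩] }
  have cov : IsCoveringMap Z.proj :=
    IsCoveringMap.mk _ (fun _ => G) (fun x => Z.localTriv (idx x)) fun x => by
      rw [← Z.baseSet_at]; exact hidx x
  obtain ⟨x₀⟩ : Nonempty B := inferInstance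
  obtain ⟨F, ⟨-, hF⟩, -⟩ := cov.existsUnique_continuousMap_lifts (ContinuousMap.id B) x₀
    (⟨x₀, (1 : G)⟩ : Z.TotalSpace) rfl
  have hproj : ∀ x, (F x).1 = x := fun x => congrFun hF x
  let a : B → G := fun x => (F x).2
  refine ⟨a, fun i x hx => ?_⟩
  have hsrc : F x ∈ (Z.localTriv i).source := by
    rw [Z.mem_localTriv_source, ← Z.baseSet_at, hproj]; exact hx
  have hc : ContinuousAt (fun y => (Z.localTriv i (F y)).2) x :=
    (((Z.localTriv i).continuousOn.continuousAt
      ((Z.localTriv i).open_source.mem_nhds hsrc)).comp F.continuous.continuousAt).snd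
  have := hc.eventually_mem (isOpen_discrete {(Z.localTriv i (F x)).2} |>.mem_nhds rfl)
  filter_upwards [this] with y hy
  have hy : (Z.localTriv i (F y)).2 = (Z.localTriv i (F x)).2 := hy
  rw [Z.localTriv_apply, Z.localTriv_apply] at hy
  have e : ∀ w, (Z.coordChange (Z.indexAt (F w).1) i (F w).1 (F w).2 : G) =
      h i (idx w) * a w := fun w => by
    change h i (idx (F w).1) * a w = _
    rw [hproj]
  rw [e, e] at hy
  exact hy

/-! ## Jumps of locally constant functions on circles -/

/-- `L` and `R` are the one-sided limits of `ψ`. Multiplying `L` by the ratios `L / R` already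
passed compensates every jump, so the product is constant on `[0, 1]`; its end values compare
because `0` and `1` are the same point of the circle. -/
theorem prod_left_div_right_circle {A : Type*} [CommGroup A] (ψ L R : UnitAddCircle → A)
    (F : Finset UnitAddCircle)
    (hL : ∀ x, ∀ᶠ s : ℝ in 𝓝[>] 0, ψ (x + ((-s : ℝ) : UnitAddCircle)) = L x)
    (hR : ∀ x, ∀ᶠ s : ℝ in 𝓝[>] 0, ψ (x + (s : UnitAddCircle)) = R x)
    (hF : ∀ x, x ∉ F → L x = R x) : ∏ x ∈ F, L x / R x = 1 := by
  classical
  let rep : UnitAddCircle → ℝ := fun x => (AddCircle.equivIco (1 : ℝ) 0 x : ℝ)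
  have rep_mem : ∀ x, 0 ≤ rep x ∧ rep x < 1 := fun x => by
    have := (AddCircle.equivIco (1 : ℝ) 0 x).2
    simpa using this
  have rep_coe : ∀ x, ((rep x : ℝ) : UnitAddCircle) = x := fun x =>
    (AddCircle.equivIco (1 : ℝ) 0).symm_apply_apply x
  have coe_rep : ∀ t : ℝ, 0 ≤ t → t < 1 → rep (t : UnitAddCircle) = t := fun t h0 h1 => by
    have : (AddCircle.equivIco (1 : ℝ) 0) ((⟨t, by simp [h0, h1]⟩ : Set.Ico (0 : ℝ) (0 + 1)) : ℝ) =
        ⟨t, by simp [h0, h1]⟩ := (AddCircle.equivIco (1 : ℝ) 0).apply_symm_apply _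
    exact congrArg Subtype.val this
  -- Just to the left of `t` the function `ψ` is constant with value `L t`. The left limit at a
  -- nearby `y < t` is computed from these same values.
  have hleft : ∀ t : ℝ, ∃ δ > 0, ∀ y : ℝ, t - δ < y → y < t → L (y : UnitAddCircle) = L t := by
    intro t
    obtain ⟨δ, hδ, h⟩ := mem_nhdsGT_iff_exists_Ioo_subset.1 (hL t)
    refine ⟨δ, hδ, fun y h1 h2 => ?_⟩
    have hs : ∀ᶠ s : ℝ in 𝓝[>] 0, s < y - (t - δ) :=
      nhdsWithin_le_nhds (eventually_lt_nhds (by linarith))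
    obtain ⟨s, h3, h4, h5⟩ := ((hL y).and (hs.and self_mem_nhdsWithin)).exists
    have h5 : (0 : ℝ) < s := h5
    have h6 : ψ ((t : UnitAddCircle) + ((-(t - y + s) : ℝ) : UnitAddCircle)) = L t :=
      h ⟨by linarith, by linarith⟩
    rw [← h3, ← h6, ← AddCircle.coe_add, ← AddCircle.coe_add]
    congr 2; ring
  have hright : ∀ t : ℝ, ∃ δ > 0, ∀ y : ℝ, t < y → y < t + δ → L (y : UnitAddCircle) = R t := by
    intro t
    obtain ⟨δ, hδ, h⟩ := mem_nhdsGT_iff_exists_Ioo_subset.1 (hR t)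
    refine ⟨δ, hδ, fun y h1 h2 => ?_⟩
    have hs : ∀ᶠ s : ℝ in 𝓝[>] 0, s < y - t :=
      nhdsWithin_le_nhds (eventually_lt_nhds (by linarith))
    obtain ⟨s, h3, h4, h5⟩ := ((hL y).and (hs.and self_mem_nhdsWithin)).exists
    have h5 : (0 : ℝ) < s := h5
    have h6 : ψ ((t : UnitAddCircle) + ((y - t - s : ℝ) : UnitAddCircle)) = R t :=
      h ⟨by linarith, by linarith⟩
    rw [← h3, ← h6, ← AddCircle.coe_add, ← AddCircle.coe_add]
    congr 2; ring
  -- The inequality is strict: `L` is the limit from the left, so the ratio at `t` itself must enter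
  -- only beyond `t`.
  let J : ℝ → A := fun t => ∏ x ∈ F with rep x < t, L x / R x
  have key : ∀ x ∈ Set.Icc (0 : ℝ) 1, ∀ᶠ y : ℝ in 𝓝[Set.Icc (0 : ℝ) 1] x,
      L (y : UnitAddCircle) * J y = L (x : UnitAddCircle) * J x := by
    intro x hx
    obtain ⟨δ₁, hδ₁, h₁⟩ := hleft x
    obtain ⟨δ₂, hδ₂, h₂⟩ := hright x
    have hfin : ∀ᶠ y in 𝓝 x, ∀ z ∈ F, rep z ≠ x → |y - x| < |rep z - x| := by
      rw [Filter.eventually_all_finset]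
      intro z _
      by_cases hz : rep z = x
      · exact Eventually.of_forall fun y h => (h hz).elim
      · have hc : ContinuousAt (fun y : ℝ => |y - x|) x := by fun_prop
        have := hc.eventually_lt (continuousAt_const (y := |rep z - x|))
          (by simpa using sub_ne_zero.2 hz)
        exact this.mono fun y hy _ => hy
    filter_upwards [self_mem_nhdsWithin, nhdsWithin_le_nhds hfin,
      nhdsWithin_le_nhds (Ioo_mem_nhds (sub_lt_self x hδ₁) (lt_add_of_pos_right x hδ₂))]
      with y hy hz hy'
    rcases lt_trichotomy y x with hlt | rfl | hgt
    · rw [h₁ y hy'.1 hlt]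
      congr 1
      refine Finset.prod_congr (Finset.filter_congr fun z hzF => ⟨fun h => h.trans hlt, fun h => ?_⟩)
        fun _ _ => rfl
      have := hz z hzF h.ne
      rw [abs_of_neg (by linarith), abs_of_neg (by linarith)] at this
      linarith
    · rfl
    · have hx1 : x < 1 := hgt.trans_le hy.2
      rw [h₂ y hgt hy'.2]
      have hJ : J y = J x * ∏ z ∈ F with rep z = x, L z / R z := by
        simp only [J]
        rw [← Finset.prod_union]
        · refine Finset.prod_congr ?_ fun _ _ => rfl
          ext z
          simp only [Finset.mem_filter, Finset.mem_union]
          refine ⟨fun h => ?_, ?_⟩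
          · rcases lt_trichotomy (rep z) x with h' | h' | h'
            · exact Or.inl ⟨h.1, h'⟩
            · exact Or.inr ⟨h.1, h'⟩
            · have := hz z h.1 h'.ne'
              rw [abs_of_pos (by linarith), abs_of_pos (by linarith)] at this
              linarith [h.2]
          · rintro (h | h)
            · exact ⟨h.1, h.2.trans hgt⟩
            · exact ⟨h.1, h.2 ▸ hgt⟩
        · rw [Finset.disjoint_filter]
          intro z _ h h'
          exact h.ne h'
      have hP : ∏ z ∈ F with rep z = x, L z / R z = L (x : UnitAddCircle) / R x := by
        by_cases hxF : (x : UnitAddCircle) ∈ F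
        · have : F.filter (fun z => rep z = x) = {(x : UnitAddCircle)} := by
            ext z
            simp only [Finset.mem_filter, Finset.mem_singleton]
            refine ⟨fun h => by rw [← rep_coe z, h.2], ?_⟩
            rintro rfl
            exact ⟨hxF, coe_rep x hx.1 hx1⟩
          rw [this, Finset.prod_singleton]
        · have : F.filter (fun z => rep z = x) = ∅ := by
            rw [Finset.filter_eq_empty_iff]
            rintro z hzF h
            rw [← h, rep_coe] at hxF
            exact hxF hzF
          rw [this, Finset.prod_empty, hF _ hxF, div_self']
      rw [hJ, hP]
      calc R (x : UnitAddCircle) * (J x * (L x / R x)) = R x * (L x / R x) * J x := by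
            rw [mul_comm (J x), mul_assoc]
        _ = L x * J x := by rw [mul_div_cancel]
  have h01 := isPreconnected_Icc.eq_of_eventually_eq key
    (Set.left_mem_Icc.2 zero_le_one) (Set.right_mem_Icc.2 zero_le_one)
  have hJ0 : J 0 = 1 := by
    simp only [J]
    rw [Finset.filter_false_of_mem fun z _ => not_lt.2 (rep_mem z).1, Finset.prod_empty]
  have hJ1 : J 1 = ∏ x ∈ F, L x / R x := by
    simp only [J]
    rw [Finset.filter_true_of_mem fun z _ => (rep_mem z).2]
  have hL1 : L ((1 : ℝ) : UnitAddCircle) = L ((0 : ℝ) : UnitAddCircle) := by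
    rw [AddCircle.coe_period, AddCircle.coe_zero]
  rw [hJ0, hJ1, hL1] at h01
  exact (mul_left_cancel h01).symm

namespace OrientedLink

variable (K : OrientedLink)

theorem prod_left_div_right {A : Type*} [CommGroup A] (ψ L R : K.Point → A) (F : Finset K.Point)
    (hL : ∀ q, ∀ᶠ s : ℝ in 𝓝[>] 0, ψ (K.shift q (-s)) = L q)
    (hR : ∀ q, ∀ᶠ s : ℝ in 𝓝[>] 0, ψ (K.shift q s) = R q)
    (hF : ∀ q, q ∉ F → L q = R q) : ∏ q ∈ F, L q / R q = 1 := by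
  classical
  let t : Fin K.n → Finset UnitAddCircle := fun i => (F.filter fun q => q.1 = i).image Prod.snd
  have ht : ∀ i x, x ∈ t i ↔ (i, x) ∈ F := fun i x => by
    simp only [t, Finset.mem_image, Finset.mem_filter]
    refine ⟨?_, fun h => ⟨_, ⟨h, rfl⟩, rfl⟩⟩
    rintro ⟨⟨j, y⟩, ⟨h, rfl⟩, rfl⟩
    exact h
  rw [Finset.prod_finset_product F Finset.univ t (fun q => by simp [ht])]
  refine Finset.prod_eq_one fun i _ => ?_
  exact prod_left_div_right_circle (fun x => ψ (i, x)) (fun x => L (i, x)) (fun x => R (i, x)) (t i)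
    (fun x => hL (i, x)) (fun x => hR (i, x)) (fun x hx => hF _ fun h => hx ((ht i x).2 h))

/-! ## Strands of a projected link -/

theorem shift_zero (q : K.Point) : K.shift q 0 = q := by
  simp [shift]

theorem shift_shift (q : K.Point) (s t : ℝ) : K.shift (K.shift q s) t = K.shift q (s + t) := by
  simp [shift, add_assoc]

theorem continuous_shift (q : K.Point) : Continuous (K.shift q) :=
  continuous_const.prodMk (continuous_const.add (AddCircle.continuous_mk' _))

/-- The projected link, parametrised so that the point `q` is at the parameter `0`. -/
def strand (q : K.Point) (s : ℝ) : ℂ := K.proj (K.shift q s)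

theorem strand_zero (q : K.Point) : K.strand q 0 = K.proj q := by
  rw [strand, shift_zero]

theorem contDiff_strand (q : K.Point) : ContDiff ℝ 1 (K.strand q) := by
  obtain ⟨i, x⟩ := q
  obtain ⟨t, rfl⟩ := QuotientAddGroup.mk_surjective x
  have h : K.strand (i, (t : UnitAddCircle)) =
      fun s : ℝ => (K.curve i ((t + s : ℝ) : UnitAddCircle)).1 := rfl
  have hs : ContDiff ℝ 1 (fun t : ℝ => K.curve i (t : UnitAddCircle)) :=
    (K.smooth i).of_le (by exact_mod_cast le_top)
  have := contDiff_fst.comp (hs.comp (contDiff_const.add contDiff_id :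
    ContDiff ℝ 1 fun s : ℝ => t + s))
  exact this

theorem deriv_strand (q : K.Point) (s : ℝ) :
    deriv (K.strand q) s = K.velocity (K.shift q s) := by
  have h : (fun t : ℝ => K.proj (K.shift (K.shift q s) t)) = fun t => K.strand q (s + t) := by
    funext t; rw [shift_shift]; rfl
  rw [velocity, h, deriv_comp_const_add, add_zero]

theorem deriv_strand_zero (q : K.Point) : deriv (K.strand q) 0 = K.velocity q := by
  rw [deriv_strand, shift_zero]

theorem isOpen_shift_image (q : K.Point) {S : Set ℝ} (hS : IsOpen S) :
    IsOpen (K.shift q '' S) := by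
  have : K.shift q '' S = {q.1} ×ˢ ((fun s : ℝ => q.2 + (s : UnitAddCircle)) '' S) := by
    ext ⟨i, x⟩
    constructor
    · rintro ⟨s, hs, h⟩
      exact ⟨(congrArg Prod.fst h).symm, s, hs, congrArg Prod.snd h⟩
    · rintro ⟨h, s, hs, h'⟩
      exact ⟨s, hs, Prod.ext (Eq.symm h) h'⟩
  rw [this]
  refine (isOpen_discrete _).prod ?_
  have h2 : (fun s : ℝ => q.2 + (s : UnitAddCircle)) '' S =
      (Homeomorph.addLeft q.2) '' ((fun s : ℝ => (s : UnitAddCircle)) '' S) := by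
    rw [Set.image_image]; rfl
  rw [h2]
  exact (Homeomorph.addLeft q.2).isOpenMap _ (QuotientAddGroup.isOpenMap_coe _ hS)

/-- The parameter space is compact, so the image of the complement of `N` is closed, and it misses
`z`. Hence near `z` only the strands through `z` are visible. -/
theorem eventually_mem_of_proj_eq {z : ℂ} {N : Set K.Point} (hN : IsOpen N)
    (h : ∀ q, K.proj q = z → q ∈ N) : ∀ᶠ w in 𝓝 z, ∀ q, K.proj q = w → q ∈ N := by
  have hc : IsClosed (K.proj '' Nᶜ) :=
    (hN.isClosed_compl.isCompact.image (Diagram.continuous_proj K)).isClosed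
  have hz : z ∉ K.proj '' Nᶜ := by
    rintro ⟨q, hq, rfl⟩
    exact hq (h q rfl)
  filter_upwards [hc.isOpen_compl.mem_nhds hz] with w hw q hq
  by_contra hqN
  exact hw ⟨q, hqN, hq⟩

theorem eq_of_proj_eq_of_height_eq {q q' : K.Point} (h : K.proj q = K.proj q')
    (h' : K.height q = K.height q') : q = q' := by
  obtain ⟨h1, h2⟩ := K.embedded q.1 q'.1 q.2 q'.2 (Prod.ext h h')
  exact Prod.ext h1 h2

theorem isClosed_range_proj : IsClosed (Set.range K.proj) :=
  (isCompact_range (Diagram.continuous_proj K)).isClosed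

/-- A `C¹` curve in the plane has dense complement for reasons of dimension; finitely many open
dense sets are intersected. -/
theorem dense_compl_range_proj : Dense (Set.range K.proj)ᶜ := by
  have h : (Set.range K.proj)ᶜ = ⋂ i : Fin K.n, (Set.range (K.strand (i, 0)))ᶜ := by
    ext z
    simp only [Set.mem_compl_iff, Set.mem_range, Set.mem_iInter, not_exists]
    constructor
    · intro hz i s; exact hz _
    · rintro hz ⟨i, x⟩ hx
      obtain ⟨t, rfl⟩ := QuotientAddGroup.mk_surjective x
      apply hz i t
      rw [← hx, strand, shift, zero_add]
  rw [h]
  refine dense_iInter_of_isOpen (fun i => ?_) fun i => ?_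
  · have : Set.range (K.strand (i, 0)) = K.proj '' ({i} ×ˢ Set.univ) := by
      ext z
      constructor
      · rintro ⟨s, rfl⟩
        exact ⟨K.shift (i, 0) s, ⟨Set.mem_singleton i, trivial⟩, rfl⟩
      · rintro ⟨⟨j, x⟩, ⟨hj, -⟩, rfl⟩
        obtain ⟨t, rfl⟩ := QuotientAddGroup.mk_surjective x
        obtain rfl : j = i := hj
        refine ⟨t, ?_⟩
        rw [strand, shift, zero_add]
    rw [this, isOpen_compl_iff]
    exact (((isClosed_discrete {i}).prod isClosed_univ).isCompact.image
      (Diagram.continuous_proj K)).isClosed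
  · exact (K.contDiff_strand (i, 0)).dense_compl_range_of_finrank_lt_finrank (by simp)

end OrientedLink

/-! ## Charts at simple points and at crossings -/

theorem planeCross_smul_right (c : ℝ) (a b : ℂ) : planeCross a (c • b) = c * planeCross a b := by
  simp [planeCross]; ring

theorem planeCross_swap (a b : ℂ) : planeCross a b = -planeCross b a := by
  simp [planeCross]; ring

/-- The open square with centre `0` and side length `2 ε` in the coordinate plane. -/
def coordBox (ε : ℝ) : Set (ℝ × ℝ) := {y | |y.1| < ε ∧ |y.2| < ε}

theorem isOpen_coordBox (ε : ℝ) : IsOpen (coordBox ε) :=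
  (isOpen_lt (continuous_abs.comp continuous_fst) continuous_const).inter
    (isOpen_lt (continuous_abs.comp continuous_snd) continuous_const)

theorem coordBox_eq_ball (ε : ℝ) : coordBox ε = Metric.ball (0 : ℝ × ℝ) ε := by
  ext y
  simp [coordBox, Prod.norm_def]

theorem exists_coordBox_subset {N : Set (ℝ × ℝ)} (hN : N ∈ 𝓝 ((0 : ℝ), (0 : ℝ))) :
    ∃ ε > 0, coordBox ε ⊆ N := by
  obtain ⟨ε, hε, h⟩ := Metric.mem_nhds_iff.1 hN
  exact ⟨ε, hε, by rw [coordBox_eq_ball]; exact h⟩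

theorem convex_coordBox (ε : ℝ) : Convex ℝ (coordBox ε) := by
  rw [coordBox_eq_ball]; exact convex_ball _ _

theorem convex_coordBox_snd (ε c : ℝ) : Convex ℝ {y ∈ coordBox ε | 0 < c * y.2} := by
  refine (convex_coordBox ε).inter ?_
  exact convex_halfSpace_gt (f := fun y : ℝ × ℝ => c * y.2)
    ⟨fun x y => by simp; ring, fun a x => by simp; ring⟩ 0

theorem convex_coordBox_fst_snd (ε b c : ℝ) :
    Convex ℝ {y ∈ coordBox ε | 0 < b * y.1 ∧ 0 < c * y.2} := by
  refine (convex_coordBox ε).inter (Convex.inter ?_ ?_)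
  · exact convex_halfSpace_gt (f := fun y : ℝ × ℝ => b * y.1)
      ⟨fun x y => by simp; ring, fun a x => by simp; ring⟩ 0
  · exact convex_halfSpace_gt (f := fun y : ℝ × ℝ => c * y.2)
      ⟨fun x y => by simp; ring, fun a x => by simp; ring⟩ 0

namespace OrientedLink

namespace Diagram

variable {L : OrientedLink} {D : L.Diagram}

/-- A chart around a simple point in which the diagram is the first coordinate axis. -/
structure IsSimpleChart (p : D.SimplePoint) (V : Set ℂ) (e : OpenPartialHomeomorph (ℝ × ℝ) ℂ)
    (ε : ℝ) : Prop where
  pos : 0 < ε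
  subset_source : coordBox ε ⊆ e.source
  mapsTo : ∀ y ∈ coordBox ε, e y ∈ V
  apply_axis : ∀ s, e (s, 0) = D.link.strand p.1 s
  eq_shift : ∀ y ∈ coordBox ε, ∀ q, D.link.proj q = e y → y.2 = 0 ∧ q = D.link.shift p.1 y.1
  ter_side : ∀ s, |s| < ε → ∀ᶠ τ : ℝ in 𝓝[>] 0, ∃ y ∈ coordBox ε, 0 < y.2 ∧
    e y = D.link.strand p.1 s + τ * D.link.normal (D.link.shift p.1 s)
  ini_side : ∀ s, |s| < ε → ∀ᶠ τ : ℝ in 𝓝[>] 0, ∃ y ∈ coordBox ε, y.2 < 0 ∧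
    e y = D.link.strand p.1 s + τ * -D.link.normal (D.link.shift p.1 s)

theorem exists_isSimpleChart (p : D.SimplePoint) {V : Set ℂ} (hV : V ∈ 𝓝 (D.link.proj p.1)) :
    ∃ e ε, IsSimpleChart p V e ε := by
  set K := D.link with hK
  have hγ₂ : ContDiff ℝ 1 (fun t : ℝ => K.proj p.1 + t * K.normal p.1) := by
    exact contDiff_const.add (Complex.ofRealCLM.contDiff.mul contDiff_const)
  have hd₂ : ∀ t : ℝ, deriv (fun t : ℝ => K.proj p.1 + t * K.normal p.1) t = K.normal p.1 := by
    intro t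
    simpa using (((Complex.ofRealCLM.hasDerivAt (x := t)).mul_const (K.normal p.1)).const_add
      (K.proj p.1)).deriv
  obtain ⟨e, he⟩ := exists_isCurveChart (K.contDiff_strand p.1) hγ₂ (by
    rw [hd₂, deriv_strand_zero, normal, planeCross_I_mul_self]
    have := norm_pos_iff.2 (D.regular.velocity_ne_zero p.1)
    positivity)
  have hax : ∀ s, e (s, 0) = K.strand p.1 s := fun s => by
    rw [he.apply_eq, strand_zero]; simp
  have hcont : ContinuousAt e (0, 0) := e.continuousAt he.zero_mem
  have h00 : e (0, 0) = K.proj p.1 := by rw [hax, strand_zero]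
  obtain ⟨ε₀, hε₀, hbox₀⟩ := exists_coordBox_subset
    (inter_mem (e.open_source.mem_nhds he.zero_mem) (hcont (by rw [h00]; exact hV)))
  -- After shrinking to `ε₁`, every diagram point in the box comes from a parameter within `ε₀` of
  -- `p`. Injectivity of the chart on the box of size `ε₀` then puts it on the axis.
  have hN := K.eventually_mem_of_proj_eq (z := K.proj p.1)
    (K.isOpen_shift_image p.1 (isOpen_Ioo (a := -ε₀) (b := ε₀)))
    (fun q hq => ⟨0, by simp [hε₀], by rw [shift_zero, p.2 q hq]⟩)
  obtain ⟨ε₁, hε₁, hbox₁⟩ := exists_coordBox_subset (hcont (by rw [h00]; exact hN))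
  have hsub₀ : coordBox (min ε₀ ε₁) ⊆ coordBox ε₀ := fun y hy =>
    ⟨hy.1.trans_le (min_le_left _ _), hy.2.trans_le (min_le_left _ _)⟩
  have hsub₁ : coordBox (min ε₀ ε₁) ⊆ coordBox ε₁ := fun y hy =>
    ⟨hy.1.trans_le (min_le_right _ _), hy.2.trans_le (min_le_right _ _)⟩
  have hpos : 0 < min ε₀ ε₁ := lt_min hε₀ hε₁
  have hmem : ∀ s, |s| < min ε₀ ε₁ → (s, (0 : ℝ)) ∈ coordBox (min ε₀ ε₁) := fun s hs =>
    ⟨hs, by simpa using hpos⟩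
  refine ⟨e, min ε₀ ε₁, hpos, fun y hy => (hbox₀ (hsub₀ hy)).1, fun y hy => (hbox₀ (hsub₀ hy)).2,
    hax, ?_, ?_, ?_⟩
  · intro y hy q hq
    obtain ⟨s, hs, rfl⟩ := hbox₁ (hsub₁ hy) q hq
    have hs0 : ((s, 0) : ℝ × ℝ) ∈ coordBox ε₀ := ⟨abs_lt.2 hs, by simpa using hε₀⟩
    have := e.injOn (hbox₀ hs0).1 (hbox₀ (hsub₀ hy)).1 ((hax s).trans hq)
    subst this
    exact ⟨rfl, rfl⟩
  · intro s hs
    filter_upwards [he.eventually_direction (hbox₀ (hsub₀ (hmem s hs))).1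
      ((isOpen_coordBox _).mem_nhds (hmem s hs)) (K.normal (K.shift p.1 s))]
    rintro τ ⟨y, hy, hy', -, -, h, -⟩
    rw [hax] at hy'
    refine ⟨y, hy, h ?_, hy'⟩
    rw [deriv_strand, normal, planeCross_I_mul_self]
    have := norm_pos_iff.2 (D.regular.velocity_ne_zero (K.shift p.1 s))
    positivity
  · intro s hs
    filter_upwards [he.eventually_direction (hbox₀ (hsub₀ (hmem s hs))).1
      ((isOpen_coordBox _).mem_nhds (hmem s hs)) (-K.normal (K.shift p.1 s))]
    rintro τ ⟨y, hy, hy', -, -, -, h⟩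
    rw [hax] at hy'
    refine ⟨y, hy, h ?_, hy'⟩
    rw [deriv_strand, normal, planeCross_neg_right, planeCross_I_mul_self]
    have := norm_pos_iff.2 (D.regular.velocity_ne_zero (K.shift p.1 s))
    simp only [Left.neg_neg_iff]
    positivity

theorem Crossing.over_ne_under (c : D.Crossing) : c.1.1 ≠ c.1.2 := fun h => by
  have := c.2.2
  rw [h] at this
  exact lt_irrefl _ this

theorem Crossing.sign_eq (c : D.Crossing) : c.sign = 1 ∨ c.sign = -1 := by
  unfold Crossing.sign; split_ifs <;> simp

theorem Crossing.sign_mul_sign (c : D.Crossing) : (c.sign : ℝ) * c.sign = 1 := by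
  rcases c.sign_eq with h | h <;> simp [h]

theorem Crossing.sign_mul_planeCross_pos (c : D.Crossing) :
    0 < (c.sign : ℝ) * planeCross (D.link.velocity c.1.1) (D.link.velocity c.1.2) := by
  have h := planeCross_ne_zero_of_linearIndependent
    (D.regular.transverse _ _ c.over_ne_under c.2.1)
  unfold Crossing.sign
  rw [normal, inner_I_mul_eq_planeCross]
  split_ifs with h'
  · simpa using h'
  · have := lt_of_le_of_ne (not_lt.1 h') h
    simpa using this

/-- A chart around a crossing in which the over-strand is the first coordinate axis and the
under-strand is the second one, directed along the normal vector of the over-strand. -/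
structure IsCrossingChart (c : D.Crossing) (V : Set ℂ) (e : OpenPartialHomeomorph (ℝ × ℝ) ℂ)
    (ε : ℝ) : Prop where
  pos : 0 < ε
  subset_source : coordBox ε ⊆ e.source
  mapsTo : ∀ y ∈ coordBox ε, e y ∈ V
  apply_over : ∀ s, e (s, 0) = D.link.strand c.1.1 s
  apply_under : ∀ t, e (0, t) = D.link.strand c.1.2 (c.sign * t)
  eq_shift : ∀ y ∈ coordBox ε, ∀ q, D.link.proj q = e y →
    (y.2 = 0 ∧ q = D.link.shift c.1.1 y.1) ∨ (y.1 = 0 ∧ q = D.link.shift c.1.2 (c.sign * y.2))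
  over_ter : ∀ s, |s| < ε → s ≠ 0 → ∀ᶠ τ : ℝ in 𝓝[>] 0, ∃ y ∈ coordBox ε, 0 < s * y.1 ∧ 0 < y.2 ∧
    e y = D.link.strand c.1.1 s + τ * D.link.normal (D.link.shift c.1.1 s)
  over_ini : ∀ s, |s| < ε → s ≠ 0 → ∀ᶠ τ : ℝ in 𝓝[>] 0, ∃ y ∈ coordBox ε, 0 < s * y.1 ∧ y.2 < 0 ∧
    e y = D.link.strand c.1.1 s + τ * -D.link.normal (D.link.shift c.1.1 s)
  under_ter : ∀ t, |t| < ε → t ≠ 0 → ∀ᶠ τ : ℝ in 𝓝[>] 0, ∃ y ∈ coordBox ε,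
    c.sign * y.1 < 0 ∧ 0 < t * y.2 ∧
    e y = D.link.strand c.1.2 (c.sign * t) + τ * D.link.normal (D.link.shift c.1.2 (c.sign * t))
  under_ini : ∀ t, |t| < ε → t ≠ 0 → ∀ᶠ τ : ℝ in 𝓝[>] 0, ∃ y ∈ coordBox ε,
    0 < c.sign * y.1 ∧ 0 < t * y.2 ∧
    e y = D.link.strand c.1.2 (c.sign * t) + τ * -D.link.normal (D.link.shift c.1.2 (c.sign * t))
  ini_cone : ∀ v : ℂ, inner ℝ v (D.link.normal c.1.1) < 0 → inner ℝ v (D.link.normal c.1.2) < 0 →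
    ∀ᶠ τ : ℝ in 𝓝[>] 0, ∃ y ∈ coordBox ε, 0 < c.sign * y.1 ∧ y.2 < 0 ∧
      e y = D.link.proj c.1.1 + τ * v

theorem exists_isCrossingChart (c : D.Crossing) {V : Set ℂ} (hV : V ∈ 𝓝 (D.link.proj c.1.1)) :
    ∃ e ε, IsCrossingChart c V e ε := by
  set K := D.link with hK
  have hγ₂ : ContDiff ℝ 1 (fun t : ℝ => K.strand c.1.2 (c.sign * t)) :=
    (K.contDiff_strand c.1.2).comp (contDiff_const.mul contDiff_id)
  have hd₂ : ∀ t : ℝ, deriv (fun t : ℝ => K.strand c.1.2 (c.sign * t)) t =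
      (c.sign : ℝ) • K.velocity (K.shift c.1.2 (c.sign * t)) := by
    intro t
    rw [deriv_comp_mul_left, deriv_strand]
  obtain ⟨e, he⟩ := exists_isCurveChart (K.contDiff_strand c.1.1) hγ₂ (by
    rw [hd₂, deriv_strand_zero, planeCross_smul_right, mul_zero, shift_zero]
    exact c.sign_mul_planeCross_pos)
  have hproj : K.proj c.1.1 = K.proj c.1.2 := c.2.1
  have hax : ∀ s, e (s, 0) = K.strand c.1.1 s := fun s => by
    rw [he.apply_eq]; simp [strand_zero, hproj]
  have hax' : ∀ t, e (0, t) = K.strand c.1.2 (c.sign * t) := fun t => by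
    rw [he.apply_eq]; simp [strand_zero]
  have hcont : ContinuousAt e (0, 0) := e.continuousAt he.zero_mem
  have h00 : e (0, 0) = K.proj c.1.1 := by rw [hax, strand_zero]
  obtain ⟨ε₀, hε₀, hbox₀⟩ := exists_coordBox_subset
    (inter_mem (e.open_source.mem_nhds he.zero_mem) (hcont (by rw [h00]; exact hV)))
  have hN := K.eventually_mem_of_proj_eq (z := K.proj c.1.1)
    ((K.isOpen_shift_image c.1.1 (isOpen_Ioo (a := -ε₀) (b := ε₀))).union
      (K.isOpen_shift_image c.1.2 (isOpen_Ioo (a := -ε₀) (b := ε₀))))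
    (fun q hq => by
      rcases D.regular.no_triple q c.1.1 c.1.2 hq hproj with h | h | h
      · exact Or.inl ⟨0, by simp [hε₀], by rw [shift_zero, h]⟩
      · exact (c.over_ne_under h).elim
      · exact Or.inr ⟨0, by simp [hε₀], by rw [shift_zero, h]⟩)
  obtain ⟨ε₁, hε₁, hbox₁⟩ := exists_coordBox_subset (hcont (by rw [h00]; exact hN))
  have hsub₀ : coordBox (min ε₀ ε₁) ⊆ coordBox ε₀ := fun y hy =>
    ⟨hy.1.trans_le (min_le_left _ _), hy.2.trans_le (min_le_left _ _)⟩
  have hsub₁ : coordBox (min ε₀ ε₁) ⊆ coordBox ε₁ := fun y hy =>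
    ⟨hy.1.trans_le (min_le_right _ _), hy.2.trans_le (min_le_right _ _)⟩
  have hpos : 0 < min ε₀ ε₁ := lt_min hε₀ hε₁
  have hsrc : coordBox (min ε₀ ε₁) ⊆ e.source := fun y hy => (hbox₀ (hsub₀ hy)).1
  have hmem : ∀ s, |s| < min ε₀ ε₁ → (s, (0 : ℝ)) ∈ coordBox (min ε₀ ε₁) := fun s hs =>
    ⟨hs, by simpa using hpos⟩
  have hmem' : ∀ s, |s| < min ε₀ ε₁ → ((0 : ℝ), s) ∈ coordBox (min ε₀ ε₁) := fun s hs =>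
    ⟨by simpa using hpos, hs⟩
  -- The condition `0 < s * y.1` keeps `y` on the same side of the under-strand as `(s, 0)`; `hN₂`
  -- does the same for the over-strand.
  have hN₁ : ∀ s, |s| < min ε₀ ε₁ → s ≠ 0 →
      coordBox (min ε₀ ε₁) ∩ {y | 0 < s * y.1} ∈ 𝓝 (s, (0 : ℝ)) := fun s hs hs0 =>
    ((isOpen_coordBox _).inter (isOpen_lt continuous_const (by fun_prop))).mem_nhds
      ⟨hmem s hs, mul_self_pos.2 hs0⟩
  have hN₂ : ∀ s, |s| < min ε₀ ε₁ → s ≠ 0 →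
      coordBox (min ε₀ ε₁) ∩ {y | 0 < s * y.2} ∈ 𝓝 ((0 : ℝ), s) := fun s hs hs0 =>
    ((isOpen_coordBox _).inter (isOpen_lt continuous_const (by fun_prop))).mem_nhds
      ⟨hmem' s hs, mul_self_pos.2 hs0⟩
  have hsq : ∀ q, 0 < ‖K.velocity q‖ ^ 2 := fun q => by
    have := norm_pos_iff.2 (D.regular.velocity_ne_zero q)
    positivity
  refine ⟨e, min ε₀ ε₁, hpos, hsrc, fun y hy => (hbox₀ (hsub₀ hy)).2, hax, hax', ?_, ?_, ?_, ?_, ?_,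
    ?_⟩
  · intro y hy q hq
    rcases hbox₁ (hsub₁ hy) q hq with ⟨s, hs, rfl⟩ | ⟨s, hs, rfl⟩
    · have hs0 : ((s, 0) : ℝ × ℝ) ∈ coordBox ε₀ := ⟨abs_lt.2 hs, by simpa using hε₀⟩
      have := e.injOn (hbox₀ hs0).1 (hsrc hy) ((hax s).trans hq)
      subst this
      exact Or.inl ⟨rfl, rfl⟩
    · have hss : (c.sign : ℝ) * (c.sign * s) = s := by
        rw [← mul_assoc, c.sign_mul_sign, one_mul]
      have hs0 : ((0, c.sign * s) : ℝ × ℝ) ∈ coordBox ε₀ := by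
        refine ⟨by simpa using hε₀, ?_⟩
        rcases c.sign_eq with h | h <;> simpa [h] using abs_lt.2 hs
      have := e.injOn (hbox₀ hs0).1 (hsrc hy) ((hax' _).trans (by rw [hss]; exact hq))
      subst this
      exact Or.inr ⟨rfl, by rw [hss]⟩
  · intro s hs hs0
    filter_upwards [he.eventually_direction (hsrc (hmem s hs)) (hN₁ s hs hs0)
      (K.normal (K.shift c.1.1 s))]
    rintro τ ⟨y, hy, hy', -, -, h, -⟩
    rw [hax] at hy'
    refine ⟨y, hy.1, hy.2, h ?_, hy'⟩
    rw [deriv_strand, normal, planeCross_I_mul_self]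
    exact hsq _
  · intro s hs hs0
    filter_upwards [he.eventually_direction (hsrc (hmem s hs)) (hN₁ s hs hs0)
      (-K.normal (K.shift c.1.1 s))]
    rintro τ ⟨y, hy, hy', -, -, -, h⟩
    rw [hax] at hy'
    refine ⟨y, hy.1, hy.2, h ?_, hy'⟩
    rw [deriv_strand, normal, planeCross_neg_right, planeCross_I_mul_self]
    exact neg_neg_of_pos (hsq _)
  · intro t ht ht0
    filter_upwards [he.eventually_direction (hsrc (hmem' t ht)) (hN₂ t ht ht0)
      (K.normal (K.shift c.1.2 (c.sign * t)))]
    rintro τ ⟨y, hy, hy', h₁, h₂, -, -⟩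
    rw [hax'] at hy'
    refine ⟨y, hy.1, ?_, hy.2, hy'⟩
    -- The second axis has `c.sign` times the velocity of the under-strand. So the left normal of
    -- the under-strand points into `c.sign * y.1 < 0`.
    rw [hd₂, planeCross_smul_right, normal, planeCross_I_mul_self_left] at h₁ h₂
    have := hsq (K.shift c.1.2 (c.sign * t))
    rcases c.sign_eq with h | h
    · rw [h] at h₁ h₂ this ⊢
      simp only [Int.cast_one, one_mul] at h₁ h₂ this ⊢
      exact h₂ (by linarith)
    · rw [h] at h₁ h₂ this ⊢
      simp only [Int.cast_neg, Int.cast_one, neg_mul, one_mul] at h₁ h₂ this ⊢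
      have := h₁ (by linarith)
      linarith
  · intro t ht ht0
    filter_upwards [he.eventually_direction (hsrc (hmem' t ht)) (hN₂ t ht ht0)
      (-K.normal (K.shift c.1.2 (c.sign * t)))]
    rintro τ ⟨y, hy, hy', h₁, h₂, -, -⟩
    rw [hax'] at hy'
    refine ⟨y, hy.1, ?_, hy.2, hy'⟩
    rw [hd₂, planeCross_smul_right, planeCross_neg_left, normal, planeCross_I_mul_self_left]
      at h₁ h₂
    have := hsq (K.shift c.1.2 (c.sign * t))
    rcases c.sign_eq with h | h
    · rw [h] at h₁ h₂ this ⊢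
      simp only [Int.cast_one, one_mul] at h₁ h₂ this ⊢
      exact h₁ (by linarith)
    · rw [h] at h₁ h₂ this ⊢
      simp only [Int.cast_neg, Int.cast_one, neg_mul, one_mul] at h₁ h₂ this ⊢
      have := h₂ (by linarith)
      linarith
  · intro v hv₁ hv₂
    rw [real_inner_comm, normal, inner_I_mul_eq_planeCross] at hv₁ hv₂
    filter_upwards [he.eventually_direction he.zero_mem
      ((isOpen_coordBox (min ε₀ ε₁)).mem_nhds (hmem 0 (by simpa using hpos))) v]
    rintro τ ⟨y, hy, hy', h₁, h₂, -, h₄⟩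
    rw [h00] at hy'
    rw [deriv_strand_zero] at h₄
    rw [hd₂, planeCross_smul_right, mul_zero, shift_zero, planeCross_swap] at h₁ h₂
    refine ⟨y, hy, ?_, h₄ hv₁, hy'⟩
    rcases c.sign_eq with h | h
    · rw [h] at h₁ h₂ ⊢
      simp only [Int.cast_one, one_mul] at h₁ h₂ ⊢
      exact h₁ (by linarith)
    · rw [h] at h₁ h₂ ⊢
      simp only [Int.cast_neg, Int.cast_one, neg_mul, one_mul] at h₁ h₂ ⊢
      have := h₂ (by linarith)
      linarith

end Diagram

end OrientedLink

theorem IsPreconnected.preimage_subtype_val {α : Type*} [TopologicalSpace α] {P : α → Prop}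
    {S : Set α} (hS : IsPreconnected S) (h : ∀ z ∈ S, P z) :
    IsPreconnected ((Subtype.val : {z // P z} → α) ⁻¹' S) := by
  have e : (Subtype.val : {z // P z} → α) '' (Subtype.val ⁻¹' S) = S :=
    Set.image_preimage_eq_of_subset fun z hz => ⟨⟨z, h z hz⟩, rfl⟩
  refine (Topology.IsInducing.subtypeVal (t := {z | P z})).isPreconnected_image.1 ?_
  exact (congrArg IsPreconnected e).mpr hS

namespace OrientedLink

namespace Diagram

variable {L : OrientedLink} {D : L.Diagram}

/-! ## Regions and arcs near a point of the diagram -/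

theorem mk_region_eq {S : Set ℂ} (hS : IsPreconnected S) (h : ∀ z ∈ S, z ∉ Set.range D.link.proj)
    {a b : ℂ} (ha : a ∈ S) (hb : b ∈ S) :
    (ConnectedComponents.mk (⟨a, h a ha⟩ : D.Exterior)) = ConnectedComponents.mk ⟨b, h b hb⟩ := by
  have hS' := hS.preimage_subtype_val h
  rw [ConnectedComponents.coe_eq_coe']
  have ha' : (⟨a, h a ha⟩ : D.Exterior) ∈ (Subtype.val : D.Exterior → ℂ) ⁻¹' S := ha
  have hb' : (⟨b, h b hb⟩ : D.Exterior) ∈ (Subtype.val : D.Exterior → ℂ) ⁻¹' S := hb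
  exact hS'.subset_connectedComponent hb' ha'

theorem mk_arc_eq {I : Set ℝ} (hI : IsPreconnected I) {g : ℝ → D.Point} (hg : Continuous g)
    (h : ∀ t ∈ I, ¬ D.IsUnder (g t)) {a b : ℝ} (ha : a ∈ I) (hb : b ∈ I) :
    (ConnectedComponents.mk (⟨g a, h a ha⟩ : D.CutCurve)) = ConnectedComponents.mk ⟨g b, h b hb⟩ := by
  have hS' := (hI.image g hg.continuousOn).preimage_subtype_val (P := fun q => ¬ D.IsUnder q)
    (by rintro _ ⟨t, ht, rfl⟩; exact h t ht)
  rw [ConnectedComponents.coe_eq_coe']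
  have ha' : (⟨g a, h a ha⟩ : D.CutCurve) ∈ (Subtype.val : D.CutCurve → D.Point) ⁻¹' (g '' I) :=
    ⟨a, ha, rfl⟩
  have hb' : (⟨g b, h b hb⟩ : D.CutCurve) ∈ (Subtype.val : D.CutCurve → D.Point) ⁻¹' (g '' I) :=
    ⟨b, hb, rfl⟩
  exact hS'.subset_connectedComponent hb' ha'

/-- Two properties of all small `s > 0` hold for a common `s`. This makes the choices by
`Classical.epsilon` unambiguous. -/
theorem PointsInto.unique {z v : ℂ} {r r' : D.Region} (h : D.PointsInto z v r)
    (h' : D.PointsInto z v r') : r = r' := by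
  obtain ⟨s, ⟨_, h₁⟩, ⟨_, h₂⟩⟩ := (Filter.Eventually.and h h').exists
  exact h₁.symm.trans h₂

theorem RunsInto.unique {q : D.Point} {d : ℝ} {a a' : D.Arc} (h : D.RunsInto q d a)
    (h' : D.RunsInto q d a') : a = a' := by
  obtain ⟨s, ⟨_, h₁⟩, ⟨_, h₂⟩⟩ := (Filter.Eventually.and h h').exists
  exact h₁.symm.trans h₂

namespace IsSimpleChart

variable {p : D.SimplePoint} {V : Set ℂ} {e : OpenPartialHomeomorph (ℝ × ℝ) ℂ} {ε : ℝ}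
  (h : IsSimpleChart p V e ε)

include h

theorem notMem_range {y : ℝ × ℝ} (hy : y ∈ coordBox ε) (h0 : y.2 ≠ 0) :
    e y ∉ Set.range D.link.proj := by
  rintro ⟨q, hq⟩
  exact h0 (h.eq_shift y hy q hq).1

theorem snd_ne_zero {y : ℝ × ℝ} (h0 : e y ∉ Set.range D.link.proj) : y.2 ≠ 0 := by
  intro h'
  have : y = (y.1, 0) := Prod.ext rfl h'
  rw [this, h.apply_axis] at h0
  exact h0 ⟨_, rfl⟩

theorem isSimple {s : ℝ} (hs : |s| < ε) : D.IsSimple (D.link.shift p.1 s) := fun q hq =>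
  (h.eq_shift (s, 0) ⟨hs, by simpa using h.pos⟩ q (by rw [hq, h.apply_axis]; rfl)).2

theorem arc_eq {s : ℝ} (hs : |s| < ε) :
    SimplePoint.arc ⟨D.link.shift p.1 s, h.isSimple hs⟩ = p.arc := by
  have hI : ∀ t ∈ Set.Ioo (-ε) ε, ¬ D.IsUnder (D.link.shift p.1 t) := fun t ht =>
    SimplePoint.not_isUnder ⟨_, h.isSimple (abs_lt.2 ht)⟩
  have := mk_arc_eq isPreconnected_Ioo (D.link.continuous_shift p.1) hI (abs_lt.1 hs)
    (show (0 : ℝ) ∈ Set.Ioo (-ε) ε from ⟨by linarith [h.pos], h.pos⟩)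
  refine this.trans ?_
  simp only [shift_zero]
  rfl

theorem image_mem_nhds : e '' coordBox ε ∈ 𝓝 (D.link.proj p.1) := by
  refine (e.isOpen_image_of_subset_source (isOpen_coordBox ε) h.subset_source).mem_nhds ?_
  exact ⟨(0, 0), ⟨by simpa using h.pos, by simpa using h.pos⟩, by rw [h.apply_axis, strand_zero]⟩

theorem isPreconnected_side (c : ℝ) : IsPreconnected (e '' {y ∈ coordBox ε | 0 < c * y.2}) :=
  (convex_coordBox_snd ε c).isPreconnected.image _
    (e.continuousOn.mono fun _ hy => h.subset_source hy.1)

theorem notMem_range_of_mem_side {c : ℝ} {w : ℂ} (hw : w ∈ e '' {y ∈ coordBox ε | 0 < c * y.2}) :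
    w ∉ Set.range D.link.proj := by
  obtain ⟨y, hy, rfl⟩ := hw
  exact h.notMem_range hy.1 (right_ne_zero_of_mul hy.2.ne')

/-- The region on the positive or on the negative side of the axis of a simple chart. -/
theorem exists_region {c : ℝ} (hc : c ≠ 0) :
    ∃ r : D.Region, ∀ w (hw : w ∈ e '' {y ∈ coordBox ε | 0 < c * y.2}),
      ConnectedComponents.mk (⟨w, h.notMem_range_of_mem_side hw⟩ : D.Exterior) = r := by
  have hε := h.pos
  -- The factor `c / |c|` is the sign of `c`, so this is a sample point on the required side,
  -- halfway to the edge of the box.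
  have hy : ((0 : ℝ), ε / 2 * (c / |c|)) ∈ {y ∈ coordBox ε | 0 < c * y.2} := by
    have hc' : 0 < |c| := abs_pos.2 hc
    refine ⟨⟨by simpa using hε, ?_⟩, ?_⟩
    · simp only [abs_mul, abs_div, abs_abs, div_self hc'.ne']
      rw [abs_of_pos (by positivity), abs_of_pos (by norm_num)]; linarith
    · have : c * (ε / 2 * (c / |c|)) = c ^ 2 * ε / (2 * |c|) := by ring
      simp only [this]
      positivity
  exact ⟨_, fun w hw => mk_region_eq (h.isPreconnected_side c)
    (fun w hw => h.notMem_range_of_mem_side hw) hw ⟨_, hy, rfl⟩⟩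

/-- Along the axis of a simple chart, the regions on the two sides do not change. -/
theorem exists_pointsInto : ∃ r r' : D.Region, ∀ s, |s| < ε →
    D.PointsInto (D.link.proj (D.link.shift p.1 s)) (-D.link.normal (D.link.shift p.1 s)) r ∧
    D.PointsInto (D.link.proj (D.link.shift p.1 s)) (D.link.normal (D.link.shift p.1 s)) r' := by
  obtain ⟨r, hr⟩ := h.exists_region (c := -1) (by norm_num)
  obtain ⟨r', hr'⟩ := h.exists_region (c := 1) (by norm_num)
  refine ⟨r, r', fun s hs => ⟨?_, ?_⟩⟩
  · filter_upwards [h.ini_side s hs]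
    rintro τ ⟨y, hy, hy0, hy'⟩
    have hm : e y ∈ e '' {y ∈ coordBox ε | 0 < (-1) * y.2} := ⟨y, ⟨hy, by linarith⟩, rfl⟩
    rw [hy'] at hm
    exact ⟨h.notMem_range_of_mem_side hm, hr _ hm⟩
  · filter_upwards [h.ter_side s hs]
    rintro τ ⟨y, hy, hy0, hy'⟩
    have hm : e y ∈ e '' {y ∈ coordBox ε | 0 < 1 * y.2} := ⟨y, ⟨hy, by linarith⟩, rfl⟩
    rw [hy'] at hm
    exact ⟨h.notMem_range_of_mem_side hm, hr' _ hm⟩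

end IsSimpleChart

theorem SimplePoint.pointsInto (p : D.SimplePoint) :
    D.PointsInto (D.link.proj p.1) (-D.link.normal p.1) p.iniRegion ∧
    D.PointsInto (D.link.proj p.1) (D.link.normal p.1) p.terRegion := by
  obtain ⟨e, ε, h⟩ := exists_isSimpleChart p univ_mem
  obtain ⟨r, r', hr⟩ := h.exists_pointsInto
  have := hr 0 (by simpa using h.pos)
  rw [shift_zero] at this
  exact ⟨Classical.epsilon_spec (p := D.PointsInto (D.link.proj p.1) (-D.link.normal p.1))
      ⟨r, this.1⟩,
    Classical.epsilon_spec (p := D.PointsInto (D.link.proj p.1) (D.link.normal p.1))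
      ⟨r', this.2⟩⟩

theorem SimplePoint.iniRegion_eq {p : D.SimplePoint} {r : D.Region}
    (h : D.PointsInto (D.link.proj p.1) (-D.link.normal p.1) r) : p.iniRegion = r :=
  p.pointsInto.1.unique h

theorem SimplePoint.terRegion_eq {p : D.SimplePoint} {r : D.Region}
    (h : D.PointsInto (D.link.proj p.1) (D.link.normal p.1) r) : p.terRegion = r :=
  p.pointsInto.2.unique h

namespace IsCrossingChart

variable {c : D.Crossing} {V : Set ℂ} {e : OpenPartialHomeomorph (ℝ × ℝ) ℂ} {ε : ℝ}
  (h : IsCrossingChart c V e ε)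

include h

theorem notMem_range {y : ℝ × ℝ} (hy : y ∈ coordBox ε) (h1 : y.1 ≠ 0) (h2 : y.2 ≠ 0) :
    e y ∉ Set.range D.link.proj := by
  rintro ⟨q, hq⟩
  rcases h.eq_shift y hy q hq with h' | h'
  · exact h2 h'.1
  · exact h1 h'.1

theorem fst_ne_zero {y : ℝ × ℝ} (h0 : e y ∉ Set.range D.link.proj) : y.1 ≠ 0 := by
  intro h'
  have : y = (0, y.2) := Prod.ext h' rfl
  rw [this, h.apply_under] at h0
  exact h0 ⟨_, rfl⟩

theorem snd_ne_zero {y : ℝ × ℝ} (h0 : e y ∉ Set.range D.link.proj) : y.2 ≠ 0 := by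
  intro h'
  have : y = (y.1, 0) := Prod.ext rfl h'
  rw [this, h.apply_over] at h0
  exact h0 ⟨_, rfl⟩

theorem isSimple_over {s : ℝ} (hs : |s| < ε) (hs0 : s ≠ 0) :
    D.IsSimple (D.link.shift c.1.1 s) := fun q hq => by
  rcases h.eq_shift (s, 0) ⟨hs, by simpa using h.pos⟩ q (by rw [hq, h.apply_over]; rfl) with h' | h'
  · exact h'.2
  · exact (hs0 h'.1).elim

theorem isSimple_under {t : ℝ} (ht : |t| < ε) (ht0 : t ≠ 0) :
    D.IsSimple (D.link.shift c.1.2 (c.sign * t)) := fun q hq => by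
  rcases h.eq_shift (0, t) ⟨by simpa using h.pos, ht⟩ q (by rw [hq, h.apply_under]; rfl) with h' | h'
  · exact (ht0 h'.1).elim
  · exact h'.2

theorem arc_over {s : ℝ} (hs : |s| < ε) (hs0 : s ≠ 0) :
    SimplePoint.arc ⟨D.link.shift c.1.1 s, h.isSimple_over hs hs0⟩ = c.overArc := by
  have hI : ∀ t ∈ Set.Ioo (-ε) ε, ¬ D.IsUnder (D.link.shift c.1.1 t) := fun t ht => by
    by_cases ht0 : t = 0
    · rw [ht0, shift_zero]; exact c.over_not_isUnder
    · exact SimplePoint.not_isUnder ⟨_, h.isSimple_over (abs_lt.2 ht) ht0⟩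
  have := mk_arc_eq isPreconnected_Ioo (D.link.continuous_shift c.1.1) hI (abs_lt.1 hs)
    (show (0 : ℝ) ∈ Set.Ioo (-ε) ε from ⟨by linarith [h.pos], h.pos⟩)
  refine this.trans ?_
  simp only [shift_zero]
  rfl

theorem arc_under_pos {t : ℝ} (ht : |t| < ε) (ht0 : 0 < t) :
    SimplePoint.arc ⟨D.link.shift c.1.2 (c.sign * t), h.isSimple_under ht ht0.ne'⟩ = c.terArc := by
  have hI : ∀ t ∈ Set.Ioo 0 ε, ¬ D.IsUnder (D.link.shift c.1.2 (c.sign * t)) := fun t ht =>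
    SimplePoint.not_isUnder ⟨_, h.isSimple_under (by rw [abs_of_pos ht.1]; exact ht.2) ht.1.ne'⟩
  have hr : D.RunsInto c.1.2 (c.sign : ℝ)
      (SimplePoint.arc ⟨D.link.shift c.1.2 (c.sign * t), h.isSimple_under ht ht0.ne'⟩) := by
    filter_upwards [Ioo_mem_nhdsGT h.pos] with s hs
    exact ⟨hI s hs, mk_arc_eq isPreconnected_Ioo
      ((D.link.continuous_shift c.1.2).comp (continuous_const.mul continuous_id)) hI hs
      ⟨ht0, (le_abs_self t).trans_lt ht⟩⟩
  exact hr.unique (@Classical.epsilon_spec _ (D.RunsInto c.1.2 (c.sign : ℝ)) ⟨_, hr⟩)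

theorem arc_under_neg {t : ℝ} (ht : |t| < ε) (ht0 : t < 0) :
    SimplePoint.arc ⟨D.link.shift c.1.2 (c.sign * t), h.isSimple_under ht ht0.ne⟩ = c.iniArc := by
  have hI : ∀ t ∈ Set.Ioo (-ε) 0, ¬ D.IsUnder (D.link.shift c.1.2 (c.sign * t)) := fun t ht =>
    SimplePoint.not_isUnder ⟨_, h.isSimple_under (by rw [abs_of_neg ht.2]; linarith [ht.1]) ht.2.ne⟩
  have hr : D.RunsInto c.1.2 (-(c.sign : ℝ))
      (SimplePoint.arc ⟨D.link.shift c.1.2 (c.sign * t), h.isSimple_under ht ht0.ne⟩) := by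
    filter_upwards [Ioo_mem_nhdsGT h.pos] with s hs
    have hs' : -s ∈ Set.Ioo (-ε) 0 := ⟨by linarith [hs.2], by linarith [hs.1]⟩
    have := mk_arc_eq isPreconnected_Ioo
      ((D.link.continuous_shift c.1.2).comp (continuous_const.mul continuous_id)) hI hs'
      ⟨by linarith [neg_abs_le t], ht0⟩
    have e1 : -(c.sign : ℝ) * s = c.sign * -s := by ring
    simp only [e1]
    exact ⟨hI _ hs', this⟩
  exact hr.unique (@Classical.epsilon_spec _ (D.RunsInto c.1.2 (-(c.sign : ℝ))) ⟨_, hr⟩)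

theorem image_mem_nhds : e '' coordBox ε ∈ 𝓝 (D.link.proj c.1.1) := by
  refine (e.isOpen_image_of_subset_source (isOpen_coordBox ε) h.subset_source).mem_nhds ?_
  exact ⟨(0, 0), ⟨by simpa using h.pos, by simpa using h.pos⟩, by rw [h.apply_over, strand_zero]⟩

theorem isPreconnected_quadrant (a b : ℝ) :
    IsPreconnected (e '' {y ∈ coordBox ε | 0 < a * y.1 ∧ 0 < b * y.2}) :=
  (convex_coordBox_fst_snd ε a b).isPreconnected.image _
    (e.continuousOn.mono fun _ hy => h.subset_source hy.1)

theorem notMem_range_of_mem_quadrant {a b : ℝ} {w : ℂ}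
    (hw : w ∈ e '' {y ∈ coordBox ε | 0 < a * y.1 ∧ 0 < b * y.2}) : w ∉ Set.range D.link.proj := by
  obtain ⟨y, hy, rfl⟩ := hw
  exact h.notMem_range hy.1 (right_ne_zero_of_mul hy.2.1.ne') (right_ne_zero_of_mul hy.2.2.ne')

theorem exists_region (a b : ℝ) :
    ∃ r : D.Region, ∀ w (hw : w ∈ e '' {y ∈ coordBox ε | 0 < a * y.1 ∧ 0 < b * y.2}),
      ConnectedComponents.mk (⟨w, h.notMem_range_of_mem_quadrant hw⟩ : D.Exterior) = r := by
  by_cases hne : (e '' {y ∈ coordBox ε | 0 < a * y.1 ∧ 0 < b * y.2}).Nonempty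
  · obtain ⟨w₀, hw₀⟩ := hne
    exact ⟨_, fun w hw => mk_region_eq (h.isPreconnected_quadrant a b)
      (fun w hw => h.notMem_range_of_mem_quadrant hw) hw hw₀⟩
  -- For `a = 0` or `b = 0` the quadrant is empty and any region serves.
  · exact ⟨Classical.arbitrary _, fun w hw => (hne ⟨w, hw⟩).elim⟩

end IsCrossingChart

end Diagram

end OrientedLink

namespace OrientedLink

namespace Diagram

variable {L : OrientedLink} {D : L.Diagram}

/-! ## Functions on the exterior with prescribed jumps across the diagram -/

/-- On `V`, the function `f` is locally constant off the diagram, and its value changes by `m p` if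
the diagram is crossed at the simple point `p` in the direction of the normal vector. -/
structure IsJumpSection {T : Type*} (m : D.SimplePoint → T → T) (f : ℂ → T) (V : Set ℂ) : Prop where
  locally_constant : ∀ w ∈ V, w ∉ Set.range D.link.proj → ∀ᶠ w' in 𝓝 w, f w' = f w
  jump : ∀ p : D.SimplePoint, D.link.proj p.1 ∈ V → ∀ᶠ τ : ℝ in 𝓝[>] 0,
    f (D.link.proj p.1 + τ * D.link.normal p.1) =
      m p (f (D.link.proj p.1 + τ * -D.link.normal p.1))

theorem IsJumpSection.mono {T : Type*} {m : D.SimplePoint → T → T} {f : ℂ → T} {V W : Set ℂ}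
    (h : IsJumpSection m f V) (hW : W ⊆ V) : IsJumpSection m f W :=
  ⟨fun w hw => h.1 w (hW hw), fun p hp => h.2 p (hW hp)⟩

theorem IsJumpSection.eq_of_isPreconnected {T : Type*} {m : D.SimplePoint → T → T} {f : ℂ → T}
    {V S : Set ℂ} (h : IsJumpSection m f V) (hS : IsPreconnected S) (hSV : S ⊆ V)
    (hSD : ∀ w ∈ S, w ∉ Set.range D.link.proj) {x y : ℂ} (hx : x ∈ S) (hy : y ∈ S) : f x = f y :=
  hS.eq_of_eventually_eq (fun w hw => nhdsWithin_le_nhds (h.1 w (hSV hw) (hSD w hw))) hx hy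

/-- A parameter point is simple, or over or under a crossing. -/
theorem isSimple_or_crossing (q : D.Point) :
    D.IsSimple q ∨ (∃ c : D.Crossing, c.1.1 = q) ∨ ∃ c : D.Crossing, c.1.2 = q := by
  by_cases hq : D.IsSimple q
  · exact Or.inl hq
  · unfold IsSimple at hq
    push Not at hq
    obtain ⟨q', hqq, hne⟩ := hq
    rcases lt_trichotomy (D.link.height q) (D.link.height q') with hlt | heq | hgt
    · exact Or.inr (Or.inr ⟨⟨(q', q), hqq, hlt⟩, rfl⟩)
    · exact (hne (D.link.eq_of_proj_eq_of_height_eq hqq heq.symm)).elim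
    · exact Or.inr (Or.inl ⟨⟨(q, q'), hqq.symm, hgt⟩, rfl⟩)

/-- A point of the plane is a point of the exterior, a simple point or a crossing. -/
theorem point_cases (z : ℂ) : z ∉ Set.range D.link.proj ∨
    (∃ p : D.SimplePoint, D.link.proj p.1 = z) ∨ ∃ c : D.Crossing, D.link.proj c.1.1 = z := by
  by_cases hz : z ∈ Set.range D.link.proj
  · obtain ⟨q, rfl⟩ := hz
    rcases D.isSimple_or_crossing q with hq | ⟨c, rfl⟩ | ⟨c, rfl⟩
    · exact Or.inr (Or.inl ⟨⟨q, hq⟩, rfl⟩)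
    · exact Or.inr (Or.inr ⟨c, rfl⟩)
    · exact Or.inr (Or.inr ⟨c, c.2.1⟩)
  · exact Or.inl hz

/-- Each side of the axis is connected, and the trivial jump at `p` equates the values on the two
sides. -/
theorem IsSimpleChart.eq_of_isJumpSection {T : Type*} {f : ℂ → T} {V : Set ℂ}
    (hf : IsJumpSection (D := D) (fun _ => id) f V) {p : D.SimplePoint}
    {e : OpenPartialHomeomorph (ℝ × ℝ) ℂ} {ε : ℝ} (h : IsSimpleChart p V e ε)
    {y y' : ℝ × ℝ} (hy : y ∈ coordBox ε) (hy' : y' ∈ coordBox ε) (h0 : y.2 ≠ 0) (h0' : y'.2 ≠ 0) :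
    f (e y) = f (e y') := by
  have same : ∀ u ∈ coordBox ε, ∀ u' ∈ coordBox ε, 0 < u.2 * u'.2 → f (e u) = f (e u') := by
    intro u hu u' hu' hpos
    refine hf.eq_of_isPreconnected (h.isPreconnected_side u.2) ?_
      (fun w hw => h.notMem_range_of_mem_side hw) ⟨u, ⟨hu, ?_⟩, rfl⟩ ⟨u', ⟨hu', hpos⟩, rfl⟩
    · rintro _ ⟨v, hv, rfl⟩
      exact h.mapsTo v hv.1
    · exact mul_self_pos.2 (left_ne_zero_of_mul hpos.ne')
  have h00 : |(0 : ℝ)| < ε := by simpa using h.pos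
  have hV : D.link.proj p.1 ∈ V := by
    rw [← strand_zero, ← h.apply_axis]; exact h.mapsTo _ ⟨h00, h00⟩
  have key : ∀ u ∈ coordBox ε, ∀ u' ∈ coordBox ε, 0 < u.2 → u'.2 < 0 → f (e u) = f (e u') := by
    intro u hu u' hu' hpos hneg
    have h1 := h.ter_side 0 h00
    have h2 := h.ini_side 0 h00
    rw [strand_zero, shift_zero] at h1 h2
    obtain ⟨τ, ⟨v, hv, hv0, hv1⟩, ⟨v', hv', hv0', hv1'⟩, hj⟩ :=
      (h1.and (h2.and (hf.jump p hV))).exists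
    rw [same u hu v hv (mul_pos hpos hv0), same u' hu' v' hv' (mul_pos_of_neg_of_neg hneg hv0'),
      hv1, hv1', hj]
    rfl
  rcases lt_or_gt_of_ne h0 with hlt | hgt <;> rcases lt_or_gt_of_ne h0' with hlt' | hgt'
  · exact same _ hy _ hy' (mul_pos_of_neg_of_neg hlt hlt')
  · exact (key _ hy' _ hy hgt' hlt).symm
  · exact key _ hy _ hy' hgt hlt'
  · exact same _ hy _ hy' (mul_pos hgt hgt')

/-- Each open quadrant is connected, and two adjacent quadrants are compared by the trivial jump at
a simple point on the half-axis between them. -/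
theorem IsCrossingChart.eq_of_isJumpSection {T : Type*} {f : ℂ → T} {V : Set ℂ}
    (hf : IsJumpSection (D := D) (fun _ => id) f V) {c : D.Crossing}
    {e : OpenPartialHomeomorph (ℝ × ℝ) ℂ} {ε : ℝ} (h : IsCrossingChart c V e ε)
    {y y' : ℝ × ℝ} (hy : y ∈ coordBox ε) (hy' : y' ∈ coordBox ε) (h1 : y.1 ≠ 0) (h2 : y.2 ≠ 0)
    (h1' : y'.1 ≠ 0) (h2' : y'.2 ≠ 0) : f (e y) = f (e y') := by
  have same : ∀ u ∈ coordBox ε, ∀ u' ∈ coordBox ε, 0 < u.1 * u'.1 → 0 < u.2 * u'.2 →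
      f (e u) = f (e u') := by
    intro u hu u' hu' hpos₁ hpos₂
    refine hf.eq_of_isPreconnected (h.isPreconnected_quadrant u.1 u.2) ?_
      (fun w hw => h.notMem_range_of_mem_quadrant hw) ⟨u, ⟨hu, ?_, ?_⟩, rfl⟩
      ⟨u', ⟨hu', hpos₁, hpos₂⟩, rfl⟩
    · rintro _ ⟨v, hv, rfl⟩
      exact h.mapsTo v hv.1
    · exact mul_self_pos.2 (left_ne_zero_of_mul hpos₁.ne')
    · exact mul_self_pos.2 (left_ne_zero_of_mul hpos₂.ne')
  have hε0 : |(0 : ℝ)| < ε := by simpa using h.pos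
  have across_over : ∀ u ∈ coordBox ε, ∀ u' ∈ coordBox ε, 0 < u.1 * u'.1 → 0 < u.2 → u'.2 < 0 →
      f (e u) = f (e u') := by
    intro u hu u' hu' hpos hu2 hu2'
    have hu0 := left_ne_zero_of_mul hpos.ne'
    have hV : D.link.proj (D.link.shift c.1.1 u.1) ∈ V := by
      have := h.mapsTo (u.1, 0) ⟨hu.1, hε0⟩
      rwa [h.apply_over] at this
    obtain ⟨τ, ⟨v, hv, hv1, hv2, hve⟩, ⟨v', hv', hv1', hv2', hve'⟩, hj⟩ :=
      ((h.over_ter u.1 hu.1 hu0).and ((h.over_ini u.1 hu.1 hu0).and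
        (hf.jump ⟨_, h.isSimple_over hu.1 hu0⟩ hV))).exists
    have hpos' : 0 < u'.1 * v'.1 := by
      have : 0 < (u.1 * u'.1) * (u.1 * v'.1) := mul_pos hpos hv1'
      have h' : (u.1 * u'.1) * (u.1 * v'.1) = u.1 ^ 2 * (u'.1 * v'.1) := by ring
      rw [h'] at this
      exact pos_of_mul_pos_right this (sq_nonneg _)
    rw [same u hu v hv hv1 (mul_pos hu2 hv2),
      same u' hu' v' hv' hpos' (mul_pos_of_neg_of_neg hu2' hv2'), hve, hve']
    exact hj
  have across_under : ∀ u ∈ coordBox ε, ∀ u' ∈ coordBox ε, c.sign * u.1 < 0 → 0 < c.sign * u'.1 →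
      0 < u.2 * u'.2 → f (e u) = f (e u') := by
    intro u hu u' hu' hu1 hu1' hpos
    have hu0 := left_ne_zero_of_mul hpos.ne'
    have hV : D.link.proj (D.link.shift c.1.2 (c.sign * u.2)) ∈ V := by
      have := h.mapsTo (0, u.2) ⟨hε0, hu.2⟩
      rwa [h.apply_under] at this
    obtain ⟨τ, ⟨v, hv, hv1, hv2, hve⟩, ⟨v', hv', hv1', hv2', hve'⟩, hj⟩ :=
      ((h.under_ter u.2 hu.2 hu0).and ((h.under_ini u.2 hu.2 hu0).and
        (hf.jump ⟨_, h.isSimple_under hu.2 hu0⟩ hV))).exists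
    have hpos' : 0 < u'.2 * v'.2 := by
      have : 0 < (u.2 * u'.2) * (u.2 * v'.2) := mul_pos hpos hv2'
      have h' : (u.2 * u'.2) * (u.2 * v'.2) = u.2 ^ 2 * (u'.2 * v'.2) := by ring
      rw [h'] at this
      exact pos_of_mul_pos_right this (sq_nonneg _)
    have hs : ∀ a b : ℝ, (c.sign * a) * (c.sign * b) = a * b := fun a b => by
      rw [mul_mul_mul_comm, c.sign_mul_sign, one_mul]
    have e1 : 0 < u.1 * v.1 := by rw [← hs]; exact mul_pos_of_neg_of_neg hu1 hv1
    have e2 : 0 < u'.1 * v'.1 := by rw [← hs]; exact mul_pos hu1' hv1'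
    rw [same u hu v hv e1 hv2, same u' hu' v' hv' e2 hpos', hve, hve']
    exact hj
  have flip₂ : ∀ u ∈ coordBox ε, u.1 ≠ 0 → u.2 ≠ 0 → f (e u) = f (e (u.1, -u.2)) := by
    intro u hu hu1 hu2
    have hu' : (u.1, -u.2) ∈ coordBox ε := ⟨hu.1, by simpa using hu.2⟩
    rcases lt_or_gt_of_ne hu2 with hlt | hgt
    · exact (across_over _ hu' _ hu (mul_self_pos.2 hu1) (neg_pos.2 hlt) hlt).symm
    · exact across_over _ hu _ hu' (mul_self_pos.2 hu1) hgt (neg_neg_of_pos hgt)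
  have flip₁ : ∀ u ∈ coordBox ε, u.1 ≠ 0 → u.2 ≠ 0 → f (e u) = f (e (-u.1, u.2)) := by
    intro u hu hu1 hu2
    have hu' : (-u.1, u.2) ∈ coordBox ε := ⟨by simpa using hu.1, hu.2⟩
    have hs0 : (c.sign : ℝ) * u.1 ≠ 0 := mul_ne_zero (left_ne_zero_of_mul_eq_one c.sign_mul_sign) hu1
    rcases lt_or_gt_of_ne hs0 with hlt | hgt
    · exact across_under _ hu _ hu' hlt (by simpa using hlt) (mul_self_pos.2 hu2)
    · exact (across_under _ hu' _ hu (by simpa using hgt) hgt (mul_self_pos.2 hu2)).symm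
  have half : ∀ u ∈ coordBox ε, u.1 ≠ 0 → u.2 ≠ 0 → 0 < u.1 * y'.1 → f (e u) = f (e y') := by
    intro u hu hu1 hu2 hpos
    rcases lt_or_gt_of_ne (mul_ne_zero hu2 h2') with hlt | hgt
    · rw [flip₂ u hu hu1 hu2]
      exact same (u.1, -u.2) ⟨hu.1, by simpa using hu.2⟩ _ hy' hpos (by rw [neg_mul]; exact neg_pos.2 hlt)
    · exact same _ hu _ hy' hpos hgt
  rcases lt_or_gt_of_ne (mul_ne_zero h1 h1') with hlt | hgt
  · rw [flip₁ y hy h1 h2]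
    exact half (-y.1, y.2) ⟨by simpa using hy.1, hy.2⟩ (neg_ne_zero.2 h1) h2
      (by rw [neg_mul]; exact neg_pos.2 hlt)
  · exact half y hy h1 h2 hgt

theorem IsJumpSection.exists_eventually_eq {T : Type*} {f : ℂ → T} {V : Set ℂ}
    (hf : IsJumpSection (D := D) (fun _ => id) f V) {z : ℂ} (hV : V ∈ 𝓝 z) :
    ∃ t, ∀ᶠ w in 𝓝 z, w ∉ Set.range D.link.proj → f w = t := by
  rcases D.point_cases z with hz | ⟨p, rfl⟩ | ⟨c, rfl⟩
  · exact ⟨f z, (hf.1 z (mem_of_mem_nhds hV) hz).mono fun w h _ => h⟩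
  · obtain ⟨e, ε, h⟩ := exists_isSimpleChart p hV
    have hε := h.pos
    refine ⟨f (e (0, ε / 2)), ?_⟩
    filter_upwards [h.image_mem_nhds]
    rintro _ ⟨y, hy, rfl⟩ hw
    refine h.eq_of_isJumpSection hf hy ⟨by simpa using hε, ?_⟩ (h.snd_ne_zero hw) (half_pos hε).ne'
    rw [abs_of_pos (half_pos hε)]; exact half_lt_self hε
  · obtain ⟨e, ε, h⟩ := exists_isCrossingChart c hV
    have hε := h.pos
    refine ⟨f (e (ε / 2, ε / 2)), ?_⟩
    filter_upwards [h.image_mem_nhds]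
    rintro _ ⟨y, hy, rfl⟩ hw
    have h2 : |ε / 2| < ε := by rw [abs_of_pos (half_pos hε)]; exact half_lt_self hε
    exact h.eq_of_isJumpSection hf hy ⟨h2, h2⟩ (h.fst_ne_zero hw) (h.snd_ne_zero hw)
      (half_pos hε).ne' (half_pos hε).ne'

/-- A function on the exterior which does not change across the diagram is constant. -/
theorem IsJumpSection.eq_of_isOpen {T : Type*} {f : ℂ → T} {V : Set ℂ}
    (hf : IsJumpSection (D := D) (fun _ => id) f V) (hV : IsOpen V) (hc : IsPreconnected V)
    {w w' : ℂ} (hw : w ∈ V) (hw' : w' ∈ V) (h0 : w ∉ Set.range D.link.proj)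
    (h0' : w' ∉ Set.range D.link.proj) : f w = f w' := by
  classical
  have hex : ∀ z : V, ∃ t, ∀ᶠ w in 𝓝 (z : ℂ), w ∉ Set.range D.link.proj → f w = t :=
    fun z => hf.exists_eventually_eq (hV.mem_nhds z.2)
  choose t ht using hex
  -- `F` extends `f` over the diagram by its local value. Neighbouring local values agree because
  -- points off the diagram are dense, so `F` is locally constant on all of `V`.
  let F : ℂ → T := fun z => if hz : z ∈ V then t ⟨z, hz⟩ else f w
  have hF : ∀ z ∈ V, ∀ᶠ u in 𝓝 z, u ∉ Set.range D.link.proj → f u = F z := fun z hz => by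
    simp only [F, dif_pos hz]; exact ht ⟨z, hz⟩
  have hloc : ∀ z ∈ V, ∀ᶠ u in 𝓝[V] z, F u = F z := by
    intro z hz
    filter_upwards [nhdsWithin_le_nhds (eventually_eventually_nhds.2 (hF z hz)),
      self_mem_nhdsWithin] with u hu huV
    obtain ⟨v, hv, hv1, hv2⟩ :=
      D.link.dense_compl_range_proj.inter_nhds_nonempty (hu.and (hF u huV))
    rw [← hv1 hv, ← hv2 hv]
  rw [(hF w hw).self_of_nhds h0, (hF w' hw').self_of_nhds h0']
  exact hc.eq_of_eventually_eq hloc hw hw'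

/-! ## Existence of functions with prescribed jumps -/

section Existence

variable {X : Type*} [Quandle X]

/-- Self-distributivity in operator form: the two ways around a crossing to the opposite region give
the same permutation. -/
theorem _root_.Rack.act'_mul_act' (a b : X) :
    Rack.act' (a ◃ b) * Rack.act' a = Rack.act' a * Rack.act' b := by
  rw [Rack.ad_conj, inv_mul_cancel_right]

/-- The solution is the identity on the initial side and picks up the operator of each strand
crossed. Permutations are used in place of colours so that two solutions differ by a constant factor
on the right, untouched by the jumps, which act on the left. -/
theorem exists_isJumpSection_local (col : D.Arc → X)
    (hcol : ∀ c : D.Crossing, col c.overArc ◃ col c.iniArc = col c.terArc) (z : ℂ) :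
    ∃ V ∈ 𝓝 z, ∃ g : ℂ → Equiv.Perm X,
      IsJumpSection (fun p : D.SimplePoint => fun x => Rack.act' (col p.arc) * x) g V := by
  classical
  rcases D.point_cases z with hz | ⟨p, rfl⟩ | ⟨c, rfl⟩
  · refine ⟨_, D.link.isClosed_range_proj.isOpen_compl.mem_nhds hz, fun _ => 1,
      fun w _ _ => Eventually.of_forall fun _ => rfl, fun p hp => (hp ⟨p.1, rfl⟩).elim⟩
  · obtain ⟨e, ε, h⟩ := exists_isSimpleChart p univ_mem
    have hmem : ∀ y ∈ coordBox ε, e.symm (e y) = y := fun y hy => e.left_inv (h.subset_source hy)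
    refine ⟨_, h.image_mem_nhds,
      fun w => if 0 < (e.symm w).2 then Rack.act' (col p.arc) else 1, ?_, ?_⟩
    · rintro _ ⟨y, hy, rfl⟩ hw
      have hy0 := h.snd_ne_zero hw
      have hc : ContinuousAt (fun w => (e.symm w).2) (e y) :=
        (e.continuousAt_symm (e.map_source (h.subset_source hy))).snd
      rcases lt_or_gt_of_ne hy0 with hlt | hgt
      · filter_upwards [hc.eventually_lt continuousAt_const (by rw [hmem y hy]; exact hlt)]
          with w' hw'
        rw [if_neg hw'.not_gt, if_neg (by rw [hmem y hy]; exact hlt.not_gt)]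
      · filter_upwards [continuousAt_const.eventually_lt hc (by rw [hmem y hy]; exact hgt)]
          with w' hw'
        rw [if_pos hw', if_pos (by rw [hmem y hy]; exact hgt)]
    · rintro ⟨q, hq⟩ ⟨y, hy, hyq⟩
      obtain ⟨-, rfl⟩ := h.eq_shift y hy q hyq.symm
      rw [h.arc_eq hy.1]
      filter_upwards [h.ter_side y.1 hy.1, h.ini_side y.1 hy.1]
      rintro τ ⟨u, hu, hu0, hue⟩ ⟨u', hu', hu0', hue'⟩
      change e u = D.link.proj (D.link.shift p.1 y.1) + _ at hue
      change e u' = D.link.proj (D.link.shift p.1 y.1) + _ at hue'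
      simp only [← hue, ← hue', hmem u hu, hmem u' hu', if_pos hu0, if_neg hu0'.not_gt, mul_one]
  · obtain ⟨e, ε, h⟩ := exists_isCrossingChart c univ_mem
    have hmem : ∀ y ∈ coordBox ε, e.symm (e y) = y := fun y hy => e.left_inv (h.subset_source hy)
    have hs0 : (c.sign : ℝ) ≠ 0 := left_ne_zero_of_mul_eq_one c.sign_mul_sign
    -- The initial quadrant has value `1`. The opposite one gets the product for the path across the
    -- initial under-arc and then the over-arc; the other path is checked by `Rack.act'_mul_act'`.
    refine ⟨_, h.image_mem_nhds,
      fun w => (if 0 < (e.symm w).2 then Rack.act' (col c.overArc) else 1) *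
        (if c.sign * (e.symm w).1 < 0 then Rack.act' (col c.iniArc) else 1), ?_, ?_⟩
    · rintro _ ⟨y, hy, rfl⟩ hw
      have hy1 := mul_ne_zero hs0 (h.fst_ne_zero hw)
      have hy2 := h.snd_ne_zero hw
      have hcont := e.continuousAt_symm (e.map_source (h.subset_source hy))
      have hc2 : ContinuousAt (fun w => (e.symm w).2) (e y) := hcont.snd
      have hc1 : ContinuousAt (fun w => (c.sign : ℝ) * (e.symm w).1) (e y) :=
        continuousAt_const.mul hcont.fst
      have e2 : ∀ᶠ w' in 𝓝 (e y), (0 < (e.symm w').2 ↔ 0 < (e.symm (e y)).2) := by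
        rw [hmem y hy]
        rcases lt_or_gt_of_ne hy2 with hlt | hgt
        · filter_upwards [hc2.eventually_lt continuousAt_const (by rw [hmem y hy]; exact hlt)]
            with w' hw'
          exact iff_of_false hw'.not_gt hlt.not_gt
        · filter_upwards [continuousAt_const.eventually_lt hc2 (by rw [hmem y hy]; exact hgt)]
            with w' hw'
          exact iff_of_true hw' hgt
      have e1 : ∀ᶠ w' in 𝓝 (e y), (c.sign * (e.symm w').1 < 0 ↔ c.sign * (e.symm (e y)).1 < 0) := by
        rw [hmem y hy]
        rcases lt_or_gt_of_ne hy1 with hlt | hgt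
        · filter_upwards [hc1.eventually_lt continuousAt_const (by rw [hmem y hy]; exact hlt)]
            with w' hw'
          exact iff_of_true hw' hlt
        · filter_upwards [continuousAt_const.eventually_lt hc1 (by rw [hmem y hy]; exact hgt)]
            with w' hw'
          exact iff_of_false hw'.not_gt hgt.not_gt
      filter_upwards [e1, e2] with w' h1 h2
      simp only [h1, h2]
    · rintro ⟨q, hq⟩ ⟨y, hy, hyq⟩
      have hzero : ¬ D.IsSimple (D.link.shift c.1.1 0) ∧
          ¬ D.IsSimple (D.link.shift c.1.2 (c.sign * 0)) := by
        rw [mul_zero, shift_zero, shift_zero]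
        exact ⟨fun hsimp => c.over_ne_under (hsimp _ c.2.1.symm).symm,
          fun hsimp => c.over_ne_under (hsimp _ c.2.1)⟩
      rcases h.eq_shift y hy q hyq.symm with ⟨-, rfl⟩ | ⟨-, rfl⟩
      · have hy0 : y.1 ≠ 0 := fun h0 => hzero.1 (h0 ▸ hq)
        rw [h.arc_over hy.1 hy0]
        filter_upwards [h.over_ter y.1 hy.1 hy0, h.over_ini y.1 hy.1 hy0]
        rintro τ ⟨u, hu, hu1, hu2, hue⟩ ⟨u', hu', hu1', hu2', hue'⟩
        change e u = D.link.proj (D.link.shift c.1.1 y.1) + _ at hue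
        change e u' = D.link.proj (D.link.shift c.1.1 y.1) + _ at hue'
        have hiff : c.sign * u.1 < 0 ↔ c.sign * u'.1 < 0 := by
          have : 0 < u.1 * u'.1 := by
            have h3 := mul_pos hu1 hu1'
            have h4 : y.1 * u.1 * (y.1 * u'.1) = y.1 ^ 2 * (u.1 * u'.1) := by ring
            rw [h4] at h3
            exact pos_of_mul_pos_right h3 (sq_nonneg _)
          have h5 : 0 < (c.sign * u.1) * (c.sign * u'.1) := by
            rwa [mul_mul_mul_comm, c.sign_mul_sign, one_mul]
          rw [← neg_iff_neg_of_mul_pos h5]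
        simp only [← hue, ← hue', hmem u hu, hmem u' hu', if_pos hu2, if_neg hu2'.not_gt, one_mul,
          hiff]
      · have hy0 : y.2 ≠ 0 := fun h0 => hzero.2 (h0 ▸ hq)
        filter_upwards [h.under_ter y.2 hy.2 hy0, h.under_ini y.2 hy.2 hy0]
        rintro τ ⟨u, hu, hu1, hu2, hue⟩ ⟨u', hu', hu1', hu2', hue'⟩
        change e u = D.link.proj (D.link.shift c.1.2 (c.sign * y.2)) + _ at hue
        change e u' = D.link.proj (D.link.shift c.1.2 (c.sign * y.2)) + _ at hue'
        simp only [← hue, ← hue', hmem u hu, hmem u' hu', if_pos hu1, if_neg hu1'.not_gt, mul_one]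
        rcases lt_or_gt_of_ne hy0 with hlt | hgt
        · have h1 : ¬ 0 < u.2 := (neg_of_mul_pos_right hu2 hlt.le).not_gt
          have h1' : ¬ 0 < u'.2 := (neg_of_mul_pos_right hu2' hlt.le).not_gt
          rw [if_neg h1, if_neg h1', h.arc_under_neg hy.2 hlt, one_mul, mul_one]
        · have h1 : 0 < u.2 := pos_of_mul_pos_right hu2 hgt.le
          have h1' : 0 < u'.2 := pos_of_mul_pos_right hu2' hgt.le
          rw [if_pos h1, if_pos h1', h.arc_under_pos hy.2 hgt, ← hcol, Rack.act'_mul_act']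

/-- The local solutions on discs differ by constants `h i j` forming a Čech cocycle. Over the simply
connected plane it is a coboundary, and correcting by it glues the solutions. -/
theorem exists_isJumpSection (col : D.Arc → X)
    (hcol : ∀ c : D.Crossing, col c.overArc ◃ col c.iniArc = col c.terArc) :
    ∃ g : ℂ → Equiv.Perm X,
      IsJumpSection (fun p : D.SimplePoint => fun x => Rack.act' (col p.arc) * x) g Set.univ := by
  classical
  have hloc : ∀ z : ℂ, ∃ r > 0, ∃ g : ℂ → Equiv.Perm X,
      IsJumpSection (fun p : D.SimplePoint => fun x => Rack.act' (col p.arc) * x) g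
        (Metric.ball z r) := fun z => by
    obtain ⟨V, hV, g, hg⟩ := exists_isJumpSection_local col hcol z
    obtain ⟨r, hr, hrV⟩ := Metric.mem_nhds_iff.1 hV
    exact ⟨r, hr, g, hg.mono hrV⟩
  choose r hr g hg using hloc
  have hH : ∀ i j : ℂ, ∃ h : Equiv.Perm X, ∀ w ∈ Metric.ball i (r i) ∩ Metric.ball j (r j),
      w ∉ Set.range D.link.proj → g j w = g i w * h := by
    intro i j
    by_cases hne : ∃ w₀ ∈ Metric.ball i (r i) ∩ Metric.ball j (r j), w₀ ∉ Set.range D.link.proj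
    · obtain ⟨w₀, hw₀, hw₀'⟩ := hne
      -- In the quotient the left factors of the jumps cancel, so it is constant off the diagram on
      -- the convex intersection of the two discs.
      refine ⟨(g i w₀)⁻¹ * g j w₀, fun w hw hw' => ?_⟩
      have hf : IsJumpSection (D := D) (fun _ => id) (fun w => (g i w)⁻¹ * g j w)
          (Metric.ball i (r i) ∩ Metric.ball j (r j)) := by
        refine ⟨fun u hu hu' => ?_, fun p hp => ?_⟩
        · filter_upwards [(hg i).1 u hu.1 hu', (hg j).1 u hu.2 hu'] with v h1 h2
          rw [h1, h2]
        · filter_upwards [(hg i).2 p hp.1, (hg j).2 p hp.2] with τ h1 h2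
          rw [h1, h2, mul_inv_rev, mul_assoc, inv_mul_cancel_left]
          rfl
      have := hf.eq_of_isOpen (Metric.isOpen_ball.inter Metric.isOpen_ball)
        ((convex_ball i (r i)).inter (convex_ball j (r j))).isPreconnected hw₀ hw hw₀' hw'
      rw [this, mul_inv_cancel_left]
    · push Not at hne
      exact ⟨1, fun w hw hw' => (hw' (hne w hw)).elim⟩
  choose h hh using hH
  obtain ⟨a, ha⟩ := exists_locally_constant_trivialization (B := ℂ)
    (fun i : ℂ => Metric.ball i (r i)) (fun i => Metric.isOpen_ball) id
    (fun x => Metric.mem_ball_self (hr x)) h (fun i j k x hx => by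
      have ho : Metric.ball i (r i) ∩ Metric.ball j (r j) ∩ Metric.ball k (r k) ∈ 𝓝 x :=
        ((Metric.isOpen_ball.inter Metric.isOpen_ball).inter Metric.isOpen_ball).mem_nhds hx
      obtain ⟨w, hw, hw'⟩ := D.link.dense_compl_range_proj.inter_nhds_nonempty ho
      have h1 := hh i j w ⟨hw'.1.1, hw'.1.2⟩ hw
      have h2 := hh j k w ⟨hw'.1.2, hw'.2⟩ hw
      have h3 := hh i k w ⟨hw'.1.1, hw'.2⟩ hw
      rw [h1, h3, mul_assoc] at h2
      exact (mul_left_cancel h2).symm)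
  -- Near `z`, the glued function is the single local solution `g z` times a constant, and so
  -- inherits its jumps.
  have key : ∀ z : ℂ, ∀ᶠ w in 𝓝 z, w ∉ Set.range D.link.proj →
      g w w * a w = g z w * (h z z * a z) := by
    intro z
    filter_upwards [ha z z (Metric.mem_ball_self (hr z)), Metric.ball_mem_nhds z (hr z)]
      with w hw hwz hw'
    rw [hh z w w ⟨hwz, Metric.mem_ball_self (hr w)⟩ hw', mul_assoc]
    congr 1
  refine ⟨fun w => g w w * a w, fun z _ hz => ?_, fun p _ => ?_⟩
  · filter_upwards [key z, (hg z).1 z (Metric.mem_ball_self (hr z)) hz,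
      D.link.isClosed_range_proj.isOpen_compl.mem_nhds hz] with w h1 h2 h3
    rw [h1 h3, h2, (key z).self_of_nhds hz]
  · obtain ⟨h1, h2⟩ := p.pointsInto
    have ht : ∀ v : ℂ, Tendsto (fun τ : ℝ => D.link.proj p.1 + τ * v) (𝓝[>] 0)
        (𝓝 (D.link.proj p.1)) := fun v => by
      have : ContinuousAt (fun τ : ℝ => D.link.proj p.1 + τ * v) 0 := by fun_prop
      have := this.tendsto
      simp only [Complex.ofReal_zero, zero_mul, add_zero] at this
      exact this.mono_left nhdsWithin_le_nhds
    filter_upwards [h1, h2, (ht _).eventually (key (D.link.proj p.1)),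
      (ht _).eventually (key (D.link.proj p.1)),
      (hg (D.link.proj p.1)).2 p (Metric.mem_ball_self (hr _))]
    rintro τ ⟨m1, -⟩ ⟨m2, -⟩ h3 h4 h5
    rw [h3 m2, h4 m1, h5, mul_assoc]

end Existence

end Diagram

end OrientedLink

namespace OrientedLink

namespace Diagram

variable {L : OrientedLink} {D : L.Diagram} {X : Type*} [Quandle X]

/-! ## Shadow colourings with given colours of the arcs -/

namespace ShadowColouring

theorem ext_colour_shadow {C C' : D.ShadowColouring X} (h : C.colour = C'.colour)
    (h' : C.shadow = C'.shadow) : C = C' := by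
  cases C; cases C'; simp_all

open Classical in
/-- The shadow of a colouring as a function on the plane (with an arbitrary value on the diagram). -/
noncomputable def planeShadow (C : D.ShadowColouring X) (z : ℂ) : X :=
  if h : z ∉ Set.range D.link.proj then C.shadow (ConnectedComponents.mk ⟨z, h⟩)
  else C.shadow (Classical.arbitrary _)

theorem planeShadow_eq (C : D.ShadowColouring X) {z : ℂ} (h : z ∉ Set.range D.link.proj) :
    C.planeShadow z = C.shadow (ConnectedComponents.mk ⟨z, h⟩) := dif_pos h

theorem isJumpSection (C : D.ShadowColouring X) :
    IsJumpSection (fun p : D.SimplePoint => fun x => C.colour p.arc ◃ x) C.planeShadow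
      Set.univ := by
  refine ⟨fun w _ hw => ?_, fun p _ => ?_⟩
  · obtain ⟨r, hr, hball⟩ := Metric.isOpen_iff.1 D.link.isClosed_range_proj.isOpen_compl w hw
    filter_upwards [Metric.ball_mem_nhds w hr] with w' hw'
    rw [C.planeShadow_eq hw, C.planeShadow_eq (hball hw')]
    congr 1
    exact mk_region_eq (convex_ball w r).isPreconnected hball hw' (Metric.mem_ball_self hr)
  · filter_upwards [p.pointsInto.1, p.pointsInto.2]
    rintro τ ⟨h1, h1'⟩ ⟨h2, h2'⟩
    rw [C.planeShadow_eq h1, C.planeShadow_eq h2, h1', h2', C.shadow_ter]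

/-- A shadow colouring is determined by the colours of the arcs and of one region. -/
theorem eq_of_colour_eq {C C' : D.ShadowColouring X} (h : C.colour = C'.colour) {r : D.Region}
    (hr : C.shadow r = C'.shadow r) : C = C' := by
  refine ext_colour_shadow h (funext fun r' => ?_)
  -- Whether the two shadows agree is a function with values in `Prop`. It does not jump, since both
  -- shadows change by the same bijection.
  have hf : IsJumpSection (D := D) (fun _ => id)
      (fun w => C.planeShadow w = C'.planeShadow w) Set.univ := by
    refine ⟨fun w hw hw' => ?_, fun p hp => ?_⟩
    · filter_upwards [C.isJumpSection.1 w hw hw', C'.isJumpSection.1 w hw hw'] with w' h1 h2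
      rw [h1, h2]
    · filter_upwards [C.isJumpSection.2 p hp, C'.isJumpSection.2 p hp] with τ h1 h2
      rw [h1, h2, h]
      exact propext (Rack.act' _).apply_eq_iff_eq
  obtain ⟨⟨z, hz⟩, rfl⟩ := ConnectedComponents.surjective_coe r
  obtain ⟨⟨z', hz'⟩, rfl⟩ := ConnectedComponents.surjective_coe r'
  have := hf.eq_of_isOpen isOpen_univ isPreconnected_univ trivial trivial hz hz'
  simp only [C.planeShadow_eq hz, C'.planeShadow_eq hz, C.planeShadow_eq hz',
    C'.planeShadow_eq hz'] at this
  exact this.mp hr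

theorem exists_of_colour (col : D.Arc → X)
    (hcol : ∀ c : D.Crossing, col c.overArc ◃ col c.iniArc = col c.terArc) (r : D.Region) (x : X) :
    ∃ C : D.ShadowColouring X, C.colour = col ∧ C.shadow r = x := by
  obtain ⟨g, hg⟩ := exists_isJumpSection col hcol
  obtain ⟨⟨z₀, hz₀⟩, rfl⟩ := ConnectedComponents.surjective_coe r
  let _ : TopologicalSpace X := ⊥
  have : DiscreteTopology X := ⟨rfl⟩
  -- The permutations are applied to one colour, normalised to give `x` at `z₀`.
  let f : D.Exterior → X := fun z => g z.1 ((g z₀)⁻¹ x)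
  have hf : Continuous f := by
    rw [continuous_iff_continuousAt]
    intro z
    refine tendsto_nhds_of_eventually_eq ?_
    have := continuous_subtype_val.continuousAt.eventually (hg.1 z.1 trivial z.2)
    filter_upwards [this] with z' hz'
    simp only [f, hz']
  refine ⟨⟨col, hf.connectedComponentsLift, hcol, fun p => ?_⟩, rfl, ?_⟩
  · obtain ⟨τ, ⟨h1, h1'⟩, ⟨h2, h2'⟩, h3⟩ :=
      (p.pointsInto.1.and (p.pointsInto.2.and (hg.2 p trivial))).exists
    rw [← h1', ← h2', hf.connectedComponentsLift_apply_coe, hf.connectedComponentsLift_apply_coe]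
    simp only [f, h3]
    rfl
  · refine (hf.connectedComponentsLift_apply_coe _).trans ?_
    simp [f]

/-- The product of two shadow colourings with the same colours of the arcs. -/
def shadowAct (Y C : D.ShadowColouring X) (h : Y.colour = C.colour) : D.ShadowColouring X where
  colour := C.colour
  shadow r := Y.shadow r ◃ C.shadow r
  colour_ter := C.colour_ter
  shadow_ter p := by
    rw [← Y.shadow_ter, ← C.shadow_ter, h]
    exact Shelf.self_distrib

end ShadowColouring

/-! ## The neighbourhood of a crossing -/

/-- The condition defining `iniRegion` quantifies over a cone of directions; a nonempty cone is
needed for the region to be unique. -/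
theorem Crossing.exists_ini_cone (c : D.Crossing) : ∃ v : ℂ,
    inner ℝ v (D.link.normal c.1.1) < 0 ∧ inner ℝ v (D.link.normal c.1.2) < 0 := by
  have h := planeCross_ne_zero_of_linearIndependent
    (D.regular.transverse _ _ c.over_ne_under c.2.1)
  set a := D.link.velocity c.1.1
  set b := D.link.velocity c.1.2
  have hsq : 0 < planeCross a b ^ 2 := by positivity
  -- The factor `planeCross a b` absorbs the sign of the crossing: both inner products equal
  -- `-(planeCross a b) ^ 2`.
  refine ⟨planeCross a b • a - planeCross a b • b, ?_, ?_⟩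
  · rw [real_inner_comm, normal, inner_I_mul_eq_planeCross]
    have : planeCross a (planeCross a b • a - planeCross a b • b) = -planeCross a b ^ 2 := by
      simp [planeCross]; ring
    exact this.trans_lt (neg_neg_of_pos hsq)
  · rw [real_inner_comm, normal, inner_I_mul_eq_planeCross]
    have : planeCross b (planeCross a b • a - planeCross a b • b) = -planeCross a b ^ 2 := by
      simp [planeCross]; ring
    exact this.trans_lt (neg_neg_of_pos hsq)

theorem Crossing.iniRegion_eq {c : D.Crossing} {r : D.Region}
    (h : ∀ v : ℂ, inner ℝ v (D.link.normal c.1.1) < 0 → inner ℝ v (D.link.normal c.1.2) < 0 →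
      D.PointsInto (D.link.proj c.1.1) v r) : c.iniRegion = r := by
  obtain ⟨v, h1, h2⟩ := c.exists_ini_cone
  have := Classical.epsilon_spec (p := fun r => ∀ v : ℂ,
    inner ℝ v (D.link.normal c.1.1) < 0 → inner ℝ v (D.link.normal c.1.2) < 0 →
      D.PointsInto (D.link.proj c.1.1) v r) ⟨r, h⟩
  exact (this v h1 h2).unique (h v h1 h2)

/-- The arcs and the regions at the simple points near a crossing. -/
theorem Crossing.exists_neighbourhood (c : D.Crossing) : ∃ ε > (0 : ℝ), ∃ r r' : D.Region,
    (∀ s : ℝ, |s| < ε → 0 < c.sign * s → ∃ h : D.IsSimple (D.link.shift c.1.1 s),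
      SimplePoint.arc ⟨_, h⟩ = c.overArc ∧ SimplePoint.iniRegion ⟨_, h⟩ = c.iniRegion ∧
      SimplePoint.terRegion ⟨_, h⟩ = r') ∧
    (∀ s : ℝ, |s| < ε → c.sign * s < 0 → ∃ h : D.IsSimple (D.link.shift c.1.1 s),
      SimplePoint.arc ⟨_, h⟩ = c.overArc ∧ SimplePoint.iniRegion ⟨_, h⟩ = r) ∧
    (∀ t : ℝ, |t| < ε → t < 0 → ∃ h : D.IsSimple (D.link.shift c.1.2 (c.sign * t)),
      SimplePoint.arc ⟨_, h⟩ = c.iniArc ∧ SimplePoint.iniRegion ⟨_, h⟩ = c.iniRegion ∧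
      SimplePoint.terRegion ⟨_, h⟩ = r) ∧
    (∀ t : ℝ, |t| < ε → 0 < t → ∃ h : D.IsSimple (D.link.shift c.1.2 (c.sign * t)),
      SimplePoint.arc ⟨_, h⟩ = c.terArc ∧ SimplePoint.iniRegion ⟨_, h⟩ = r') := by
  obtain ⟨e, ε, h⟩ := exists_isCrossingChart c univ_mem
  -- The quadrants are: `r₀` on the initial side of both strands, `r` across the under-strand from
  -- it, `r'` across the over-strand.
  obtain ⟨r₀, hr₀⟩ := h.exists_region c.sign (-1)
  obtain ⟨r, hr⟩ := h.exists_region (-c.sign) (-1)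
  obtain ⟨r', hr'⟩ := h.exists_region c.sign 1
  have hini : c.iniRegion = r₀ := by
    refine Crossing.iniRegion_eq fun v h1 h2 => ?_
    filter_upwards [h.ini_cone v h1 h2]
    rintro τ ⟨y, hy, hy1, hy2, hye⟩
    have hm : e y ∈ e '' {y ∈ coordBox ε | 0 < c.sign * y.1 ∧ 0 < (-1) * y.2} :=
      ⟨y, ⟨hy, hy1, by linarith⟩, rfl⟩
    rw [hye] at hm
    exact ⟨_, hr₀ _ hm⟩
  have into : ∀ {z v : ℂ} {a b : ℝ} {R : D.Region},
      (∀ w (hw : w ∈ e '' {y ∈ coordBox ε | 0 < a * y.1 ∧ 0 < b * y.2}),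
        ConnectedComponents.mk (⟨w, h.notMem_range_of_mem_quadrant hw⟩ : D.Exterior) = R) →
      (∀ᶠ τ : ℝ in 𝓝[>] 0, ∃ y ∈ coordBox ε, 0 < a * y.1 ∧ 0 < b * y.2 ∧ e y = z + τ * v) →
      D.PointsInto z v R := by
    intro z v a b R hR hev
    filter_upwards [hev]
    rintro τ ⟨y, hy, hy1, hy2, hye⟩
    have hm : e y ∈ e '' {y ∈ coordBox ε | 0 < a * y.1 ∧ 0 < b * y.2} :=
      ⟨y, ⟨hy, hy1, hy2⟩, rfl⟩
    rw [hye] at hm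
    exact ⟨_, hR _ hm⟩
  have same : ∀ {s x : ℝ}, 0 < s * x → 0 < (c.sign * s) * (c.sign * x) := fun {s x} hsx => by
    rwa [mul_mul_mul_comm, c.sign_mul_sign, one_mul]
  refine ⟨ε, h.pos, r, r', fun s hs hs0 => ?_, fun s hs hs0 => ?_, fun t ht ht0 => ?_,
    fun t ht ht0 => ?_⟩
  · have hs' : s ≠ 0 := right_ne_zero_of_mul hs0.ne'
    refine ⟨h.isSimple_over hs hs', h.arc_over hs hs', ?_, ?_⟩
    · rw [hini]
      refine SimplePoint.iniRegion_eq (into hr₀ ?_)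
      filter_upwards [h.over_ini s hs hs']
      rintro τ ⟨y, hy, hy1, hy2, hye⟩
      exact ⟨y, hy, pos_of_mul_pos_right (same hy1) hs0.le, by linarith, hye⟩
    · refine SimplePoint.terRegion_eq (into hr' ?_)
      filter_upwards [h.over_ter s hs hs']
      rintro τ ⟨y, hy, hy1, hy2, hye⟩
      exact ⟨y, hy, pos_of_mul_pos_right (same hy1) hs0.le, by linarith, hye⟩
  · have hs' : s ≠ 0 := right_ne_zero_of_mul hs0.ne
    refine ⟨h.isSimple_over hs hs', h.arc_over hs hs', ?_⟩
    refine SimplePoint.iniRegion_eq (into hr ?_)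
    filter_upwards [h.over_ini s hs hs']
    rintro τ ⟨y, hy, hy1, hy2, hye⟩
    have := neg_of_mul_pos_right (same hy1) hs0.le
    exact ⟨y, hy, by linarith, by linarith, hye⟩
  · refine ⟨h.isSimple_under ht ht0.ne, h.arc_under_neg ht ht0, ?_, ?_⟩
    · rw [hini]
      refine SimplePoint.iniRegion_eq (into hr₀ ?_)
      filter_upwards [h.under_ini t ht ht0.ne]
      rintro τ ⟨y, hy, hy1, hy2, hye⟩
      have := neg_of_mul_pos_right hy2 ht0.le
      exact ⟨y, hy, hy1, by linarith, hye⟩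
    · refine SimplePoint.terRegion_eq (into hr ?_)
      filter_upwards [h.under_ter t ht ht0.ne]
      rintro τ ⟨y, hy, hy1, hy2, hye⟩
      have := neg_of_mul_pos_right hy2 ht0.le
      exact ⟨y, hy, by linarith, by linarith, hye⟩
  · refine ⟨h.isSimple_under ht ht0.ne', h.arc_under_pos ht ht0, ?_⟩
    refine SimplePoint.iniRegion_eq (into hr' ?_)
    filter_upwards [h.under_ini t ht ht0.ne']
    rintro τ ⟨y, hy, hy1, hy2, hye⟩
    have := pos_of_mul_pos_right hy2 ht0.le
    exact ⟨y, hy, hy1, by linarith, hye⟩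

/-- Near a simple point, the arc and the regions of the simple points do not change. -/
theorem SimplePoint.exists_neighbourhood (p : D.SimplePoint) : ∃ ε > (0 : ℝ), ∀ s : ℝ, |s| < ε →
    ∃ h : D.IsSimple (D.link.shift p.1 s), SimplePoint.arc ⟨_, h⟩ = p.arc ∧
      SimplePoint.iniRegion ⟨_, h⟩ = p.iniRegion := by
  obtain ⟨e, ε, h⟩ := exists_isSimpleChart p univ_mem
  obtain ⟨r, r', hr⟩ := h.exists_pointsInto
  refine ⟨ε, h.pos, fun s hs => ⟨h.isSimple hs, h.arc_eq hs, ?_⟩⟩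
  rw [SimplePoint.iniRegion_eq (hr s hs).1]
  have := hr 0 (by simpa using h.pos)
  rw [shift_zero] at this
  exact (SimplePoint.iniRegion_eq this.1).symm

/-! ### Finiteness of the set of arcs -/

/-- The parameter space is compact, and each of its points has a neighbourhood meeting at most two
arcs. -/
theorem finite_arc : Finite D.Arc := by
  have hP : ({a : D.Arc | ∃ q ∈ (Set.univ : Set D.Point), ∃ h : ¬ D.IsUnder q,
      ConnectedComponents.mk (⟨q, h⟩ : D.CutCurve) = a}).Finite := by
    refine isCompact_univ.induction_on (p := fun S : Set D.Point =>
      {a : D.Arc | ∃ q ∈ S, ∃ h : ¬ D.IsUnder q,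
        ConnectedComponents.mk (⟨q, h⟩ : D.CutCurve) = a}.Finite) ?_ ?_ ?_ ?_
    · simp
    · intro s t hst ht
      exact ht.subset fun a ⟨q, hq, h⟩ => ⟨q, hst hq, h⟩
    · intro s t hs ht
      refine (hs.union ht).subset ?_
      rintro a ⟨q, hq | hq, h⟩
      · exact Or.inl ⟨q, hq, h⟩
      · exact Or.inr ⟨q, hq, h⟩
    · intro q _
      have hnhds : ∀ {ε : ℝ}, 0 < ε →
          D.link.shift q '' Set.Ioo (-ε) ε ∈ 𝓝[Set.univ] q := fun {ε} hε => by
        rw [nhdsWithin_univ]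
        exact (D.link.isOpen_shift_image q isOpen_Ioo).mem_nhds
          ⟨0, by simp [hε], D.link.shift_zero q⟩
      rcases D.isSimple_or_crossing q with hq | ⟨c, rfl⟩ | ⟨c, rfl⟩
      · obtain ⟨ε, hε, h⟩ := SimplePoint.exists_neighbourhood ⟨q, hq⟩
        refine ⟨_, hnhds hε, (Set.finite_singleton (SimplePoint.arc ⟨q, hq⟩)).subset ?_⟩
        rintro a ⟨_, ⟨s, hs, rfl⟩, hu, rfl⟩
        obtain ⟨_, h', -⟩ := h s (abs_lt.2 hs)
        exact h'
      · obtain ⟨ε, hε, r, r', h1, h2, -, -⟩ := c.exists_neighbourhood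
        refine ⟨_, hnhds hε, (Set.finite_singleton c.overArc).subset ?_⟩
        rintro a ⟨_, ⟨s, hs, rfl⟩, hu, rfl⟩
        rcases lt_trichotomy ((c.sign : ℝ) * s) 0 with hlt | heq | hgt
        · obtain ⟨_, h', -⟩ := h2 s (abs_lt.2 hs) hlt
          exact h'
        · have hs0 : s = 0 :=
            (mul_eq_zero.1 heq).resolve_left (left_ne_zero_of_mul_eq_one c.sign_mul_sign)
          subst hs0
          simp only [shift_zero]
          rfl
        · obtain ⟨_, h', -⟩ := h1 s (abs_lt.2 hs) hgt
          exact h'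
      · obtain ⟨ε, hε, r, r', -, -, h3, h4⟩ := c.exists_neighbourhood
        refine ⟨_, hnhds hε, (Set.toFinite {c.iniArc, c.terArc}).subset ?_⟩
        rintro a ⟨_, ⟨s, hs, rfl⟩, hu, rfl⟩
        have hss : s = c.sign * (c.sign * s) := by rw [← mul_assoc, c.sign_mul_sign, one_mul]
        have hs' : |c.sign * s| < ε := by
          rcases c.sign_eq with h | h <;> simpa [h] using abs_lt.2 hs
        rcases lt_trichotomy ((c.sign : ℝ) * s) 0 with hlt | heq | hgt
        · obtain ⟨_, h', -⟩ := h3 _ hs' hlt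
          left
          rw [← h']
          simp only [← hss]
          rfl
        · rw [heq, mul_zero] at hss
          rw [hss, shift_zero] at hu
          exact (hu ⟨_, c.2⟩).elim
        · obtain ⟨_, h', -⟩ := h4 _ hs' hgt
          right
          rw [Set.mem_singleton_iff, ← h']
          simp only [← hss]
          rfl
  refine Set.finite_univ_iff.1 (hP.subset fun a _ => ?_)
  obtain ⟨⟨q, hq⟩, rfl⟩ := ConnectedComponents.surjective_coe a
  exact ⟨q, trivial, hq, rfl⟩

end Diagram

end OrientedLink

/-! ## The whole weight does not depend on the colours of the regions -/

theorem IsQuandleCocycle.three_eq {X : Type*} [Quandle X] {A : Type*} [CommGroup A]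
    {φ : (Fin 3 → X) → A} (hφ : IsQuandleCocycle φ) (a x y z : X) :
    φ ![x ◃ a, y, z] / φ ![a, y, z] * (φ ![a, x, z] / φ ![y ◃ a, y ◃ x, z]) *
      (φ ![z ◃ a, z ◃ x, z ◃ y] / φ ![a, x, y]) = 1 := by
  have h := hφ.coboundary_eq_one ![a, x, y, z]
  unfold rackCoboundary at h
  rw [Fin.prod_univ_four] at h
  have one0 : rackFaceOne 0 ![a, x, y, z] = ![x, y, z] := by
    funext j; fin_cases j <;> rfl
  have zero0 : rackFaceZero 0 ![a, x, y, z] = ![x, y, z] := by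
    funext j; fin_cases j <;> rfl
  have one1 : rackFaceOne 1 ![a, x, y, z] = ![x ◃ a, y, z] := by
    funext j; fin_cases j <;> rfl
  have zero1 : rackFaceZero 1 ![a, x, y, z] = ![a, y, z] := by
    funext j; fin_cases j <;> rfl
  have one2 : rackFaceOne 2 ![a, x, y, z] = ![y ◃ a, y ◃ x, z] := by
    funext j; fin_cases j <;> rfl
  have zero2 : rackFaceZero 2 ![a, x, y, z] = ![a, x, z] := by
    funext j; fin_cases j <;> rfl
  have one3 : rackFaceOne 3 ![a, x, y, z] = ![z ◃ a, z ◃ x, z ◃ y] := by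
    funext j; fin_cases j <;> rfl
  have zero3 : rackFaceZero 3 ![a, x, y, z] = ![a, x, y] := by
    funext j; fin_cases j <;> rfl
  rw [one0, zero0, one1, zero1, one2, zero2, one3, zero3] at h
  simpa using h

namespace OrientedLink

namespace Diagram

variable {L : OrientedLink} {D : L.Diagram} {X : Type*} [Quandle X]

theorem Crossing.eq_of_over_eq {c c' : D.Crossing} (h : c.1.1 = c'.1.1) : c = c' := by
  refine Subtype.ext (Prod.ext h ?_)
  have h1 : D.link.proj c.1.2 = D.link.proj c.1.1 := c.2.1.symm
  have h2 : D.link.proj c.1.1 = D.link.proj c'.1.2 := by rw [h]; exact c'.2.1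
  rcases D.regular.no_triple _ _ _ h1 h2 with h' | h' | h'
  · exact (c.over_ne_under h'.symm).elim
  · exact (c'.over_ne_under (h.symm.trans h')).elim
  · exact h'

theorem Crossing.eq_of_under_eq {c c' : D.Crossing} (h : c.1.2 = c'.1.2) : c = c' := by
  refine Subtype.ext (Prod.ext ?_ h)
  have h1 : D.link.proj c.1.1 = D.link.proj c.1.2 := c.2.1
  have h2 : D.link.proj c.1.2 = D.link.proj c'.1.1 := by rw [h]; exact c'.2.1.symm
  rcases D.regular.no_triple _ _ _ h1 h2 with h' | h' | h'
  · exact (c.over_ne_under h').elim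
  · exact (c'.over_ne_under (h'.symm.trans h)).elim
  · exact h'

theorem Crossing.over_ne_under' (c c' : D.Crossing) : c.1.1 ≠ c'.1.2 := fun h =>
  c.over_not_isUnder ⟨c'.1.1, by rw [h]; exact c'.2⟩

namespace ShadowColouring

variable {A : Type*} [CommGroup A] {φ : (Fin 3 → X) → A}

/-- By the cocycle condition the weight of each crossing changes by jumps of one function `ψ` along
the two strands, and all jumps along closed curves multiply to `1`. -/
theorem wholeWeight_shadowAct (hφ : IsQuandleCocycle φ) (Y C : D.ShadowColouring X)
    (h : Y.colour = C.colour) : (Y.shadowAct C h).wholeWeight φ = C.wholeWeight φ := by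
  classical
  let P : D.Region → D.Arc → A := fun r a => φ ![C.shadow r, Y.shadow r, C.colour a]
  let ψ : D.Point → A := fun q =>
    if hq : D.IsSimple q then P (SimplePoint.iniRegion ⟨q, hq⟩) (SimplePoint.arc ⟨q, hq⟩) else 1
  have hψ : ∀ {q : D.Point} (hq : D.IsSimple q),
      ψ q = P (SimplePoint.iniRegion ⟨q, hq⟩) (SimplePoint.arc ⟨q, hq⟩) := fun hq => dif_pos hq
  have hIoo : ∀ {ε : ℝ}, 0 < ε → ∀ᶠ s : ℝ in 𝓝[>] 0, 0 < s ∧ |s| < ε ∧ |-s| < ε := fun {ε} hε => by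
    filter_upwards [Ioo_mem_nhdsGT hε] with s hs
    rw [abs_neg, abs_of_pos hs.1]
    exact ⟨hs.1, hs.2, hs.2⟩
  have hsimple : ∀ q, D.IsSimple q → ∃ l, (∀ᶠ s : ℝ in 𝓝[>] 0, ψ (D.link.shift q (-s)) = l) ∧
      ∀ᶠ s : ℝ in 𝓝[>] 0, ψ (D.link.shift q s) = l := by
    intro q hq
    obtain ⟨ε, hε, hn⟩ := SimplePoint.exists_neighbourhood ⟨q, hq⟩
    refine ⟨ψ q, ?_, ?_⟩
    · filter_upwards [hIoo hε] with s hs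
      obtain ⟨h1, h2, h3⟩ := hn _ hs.2.2
      rw [hψ hq, hψ h1, h2, h3]
    · filter_upwards [hIoo hε] with s hs
      obtain ⟨h1, h2, h3⟩ := hn _ hs.2.1
      rw [hψ hq, hψ h1, h2, h3]
  have hcross : ∀ c : D.Crossing, ∃ lo ro lu ru : A,
      (∀ᶠ s : ℝ in 𝓝[>] 0, ψ (D.link.shift c.1.1 (-s)) = lo) ∧
      (∀ᶠ s : ℝ in 𝓝[>] 0, ψ (D.link.shift c.1.1 s) = ro) ∧
      (∀ᶠ s : ℝ in 𝓝[>] 0, ψ (D.link.shift c.1.2 (-s)) = lu) ∧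
      (∀ᶠ s : ℝ in 𝓝[>] 0, ψ (D.link.shift c.1.2 s) = ru) ∧
      (Y.shadowAct C h).weight φ c = C.weight φ c * (lo / ro * (lu / ru)) := by
    intro c
    obtain ⟨ε, hε, r, r', h1, h2, h3, h4⟩ := c.exists_neighbourhood
    have hr : ∀ Z : D.ShadowColouring X, Z.shadow r = Z.colour c.iniArc ◃ Z.shadow c.iniRegion := by
      intro Z
      obtain ⟨_, e1, e2, e3⟩ := h3 (-(ε / 2)) (by rw [abs_neg, abs_of_pos] <;> linarith)
        (by linarith)
      rw [← e1, ← e2, ← e3, Z.shadow_ter]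
    have hr' : ∀ Z : D.ShadowColouring X, Z.shadow r' = Z.colour c.overArc ◃ Z.shadow c.iniRegion := by
      intro Z
      have hs : |c.sign * (ε / 2)| < ε ∧ 0 < c.sign * (c.sign * (ε / 2)) := by
        rw [← mul_assoc, c.sign_mul_sign, one_mul, abs_mul]
        have : |(c.sign : ℝ)| = 1 := by rcases c.sign_eq with h | h <;> simp [h]
        rw [this, one_mul, abs_of_pos (half_pos hε)]
        exact ⟨half_lt_self hε, half_pos hε⟩
      obtain ⟨_, e1, e2, e3⟩ := h1 _ hs.1 hs.2
      rw [← e1, ← e2, ← e3, Z.shadow_ter]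
    -- Of the six terms of the cocycle condition, two give the change of the weight. The other four
    -- are values of `P` next to the crossing, once the shadows at `r` and `r'` are written as
    -- images of those at the initial region.
    have hfactor : φ ![Y.shadow c.iniRegion ◃ C.shadow c.iniRegion, C.colour c.iniArc,
          C.colour c.overArc] =
        φ ![C.shadow c.iniRegion, C.colour c.iniArc, C.colour c.overArc] *
          (P r c.overArc / P c.iniRegion c.overArc * (P c.iniRegion c.iniArc / P r' c.terArc)) := by
      have hc := hφ.three_eq (C.shadow c.iniRegion) (Y.shadow c.iniRegion) (C.colour c.iniArc)
        (C.colour c.overArc)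
      simp only [P, hr, hr', h, ← C.colour_ter]
      rw [mul_assoc, div_mul_eq_mul_div, div_eq_one, ← eq_div_iff_mul_eq'] at hc
      rw [hc, div_eq_mul_inv, mul_inv, inv_div, inv_div]
    rcases c.sign_eq with hσ | hσ
    · rw [hσ] at h1 h2 h3 h4
      simp only [Int.cast_one, one_mul] at h1 h2 h3 h4
      refine ⟨P r c.overArc, P c.iniRegion c.overArc, P c.iniRegion c.iniArc, P r' c.terArc,
        ?_, ?_, ?_, ?_, ?_⟩
      · filter_upwards [hIoo hε] with s hs
        obtain ⟨e0, e1, e2⟩ := h2 _ hs.2.2 (by linarith)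
        rw [hψ e0, e1, e2]
      · filter_upwards [hIoo hε] with s hs
        obtain ⟨e0, e1, e2, -⟩ := h1 _ hs.2.1 hs.1
        rw [hψ e0, e1, e2]
      · filter_upwards [hIoo hε] with s hs
        obtain ⟨e0, e1, e2, -⟩ := h3 _ hs.2.2 (by linarith)
        rw [hψ e0, e1, e2]
      · filter_upwards [hIoo hε] with s hs
        obtain ⟨e0, e1, e2⟩ := h4 _ hs.2.1 hs.1
        rw [hψ e0, e1, e2]
      · simp only [weight, hσ, zpow_one]
        exact hfactor
    -- At a negative crossing left and right are exchanged on both strands, which inverts both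
    -- ratios, in accordance with the exponent `-1` of the weight.
    · rw [hσ] at h1 h2 h3 h4
      simp only [Int.cast_neg, Int.cast_one, neg_mul, one_mul] at h1 h2 h3 h4
      refine ⟨P c.iniRegion c.overArc, P r c.overArc, P r' c.terArc, P c.iniRegion c.iniArc,
        ?_, ?_, ?_, ?_, ?_⟩
      · filter_upwards [hIoo hε] with s hs
        obtain ⟨e0, e1, e2, -⟩ := h1 _ hs.2.2 (by linarith)
        rw [hψ e0, e1, e2]
      · filter_upwards [hIoo hε] with s hs
        obtain ⟨e0, e1, e2⟩ := h2 _ hs.2.1 (by linarith)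
        rw [hψ e0, e1, e2]
      · filter_upwards [hIoo hε] with s hs
        obtain ⟨e0, e1, e2⟩ := h4 _ hs.2.1 hs.1
        rw [hψ e0, e1, e2]
      · filter_upwards [hIoo hε] with s hs
        obtain ⟨e0, e1, e2, -⟩ := h3 _ hs.2.2 (by linarith)
        simp only [neg_neg] at e0 e1 e2
        rw [hψ e0, e1, e2]
      · simp only [weight, hσ, zpow_neg, zpow_one]
        refine (congrArg (·⁻¹) hfactor).trans ?_
        rw [mul_inv, mul_inv, inv_div, inv_div]
  have hLR : ∀ q, ∃ l r, (∀ᶠ s : ℝ in 𝓝[>] 0, ψ (D.link.shift q (-s)) = l) ∧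
      (∀ᶠ s : ℝ in 𝓝[>] 0, ψ (D.link.shift q s) = r) := by
    intro q
    rcases D.isSimple_or_crossing q with hq | ⟨c, rfl⟩ | ⟨c, rfl⟩
    · obtain ⟨l, hl⟩ := hsimple q hq
      exact ⟨l, l, hl⟩
    · obtain ⟨lo, ro, lu, ru, h1, h2, -, -, -⟩ := hcross c
      exact ⟨lo, ro, h1, h2⟩
    · obtain ⟨lo, ro, lu, ru, -, -, h1, h2, -⟩ := hcross c
      exact ⟨lu, ru, h1, h2⟩
  choose l r hl hr using hLR
  have uniq : ∀ {g : ℝ → D.Point} {a b : A}, (∀ᶠ s : ℝ in 𝓝[>] 0, ψ (g s) = a) →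
      (∀ᶠ s : ℝ in 𝓝[>] 0, ψ (g s) = b) → a = b := fun ha hb => by
    obtain ⟨s, h1, h2⟩ := (ha.and hb).exists
    exact h1.symm.trans h2
  have hw : ∀ c : D.Crossing, (Y.shadowAct C h).weight φ c =
      C.weight φ c * (l c.1.1 / r c.1.1 * (l c.1.2 / r c.1.2)) := by
    intro c
    obtain ⟨lo, ro, lu, ru, h1, h2, h3, h4, h5⟩ := hcross c
    rw [h5, uniq h1 (hl _), uniq h2 (hr _), uniq h3 (hl _), uniq h4 (hr _)]
  have : Finite D.Crossing := D.regular.finite_crossings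
  have := Fintype.ofFinite D.Crossing
  let F₁ : Finset D.Point := Finset.univ.image fun c : D.Crossing => c.1.1
  let F₂ : Finset D.Point := Finset.univ.image fun c : D.Crossing => c.1.2
  have hdisj : Disjoint F₁ F₂ := by
    rw [Finset.disjoint_left]
    intro q hq1 hq2
    obtain ⟨c, -, rfl⟩ := Finset.mem_image.1 hq1
    obtain ⟨c', -, hc⟩ := Finset.mem_image.1 hq2
    exact c.over_ne_under' c' hc.symm
  -- Off the over- and under-points `ψ` has no jump, so these points account for the whole
  -- telescoping product.
  have htel := D.link.prod_left_div_right ψ l r (F₁ ∪ F₂) hl hr fun q hq => by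
    rcases D.isSimple_or_crossing q with hq' | ⟨c, rfl⟩ | ⟨c, rfl⟩
    · obtain ⟨t, h1, h2⟩ := hsimple q hq'
      rw [uniq (hl q) h1, uniq (hr q) h2]
    · exact (hq (Finset.mem_union_left _ (Finset.mem_image_of_mem _ (Finset.mem_univ c)))).elim
    · exact (hq (Finset.mem_union_right _ (Finset.mem_image_of_mem _ (Finset.mem_univ c)))).elim
  rw [Finset.prod_union hdisj,
    Finset.prod_image fun c _ c' _ hc => Crossing.eq_of_over_eq hc,
    Finset.prod_image fun c _ c' _ hc => Crossing.eq_of_under_eq hc,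
    ← Finset.prod_mul_distrib] at htel
  unfold wholeWeight
  rw [finprod_eq_prod_of_fintype, finprod_eq_prod_of_fintype, Finset.prod_congr rfl fun c _ => hw c,
    Finset.prod_mul_distrib, htel, mul_one]

/-- For a connected quandle, the whole weight depends only on the colours of the arcs. -/
theorem wholeWeight_eq_of_colour_eq (hX : QuandleConnected X) (hφ : IsQuandleCocycle φ)
    {C C' : D.ShadowColouring X} (h : C.colour = C'.colour) :
    C.wholeWeight φ = C'.wholeWeight φ := by
  obtain ⟨r⟩ : Nonempty D.Region := inferInstance
  choose S hS hSr using exists_of_colour C.colour C.colour_ter r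
  have hC : C = S (C.shadow r) := eq_of_colour_eq (hS _).symm (hSr _).symm
  have hC' : C' = S (C'.shadow r) := eq_of_colour_eq (h.symm.trans (hS _).symm) (hSr _).symm
  -- `S x` has the given arc colours and colour `x` at `r`. By uniqueness, `S (x ◃ a)` is the
  -- product of `S x` and `S a`.
  have act : ∀ x a, (S (x ◃ a)).wholeWeight φ = (S a).wholeWeight φ := fun x a => by
    have hc : (S x).colour = (S a).colour := (hS x).trans (hS a).symm
    have : S (x ◃ a) = (S x).shadowAct (S a) hc := by
      refine eq_of_colour_eq (r := r) ((hS _).trans (hS a).symm) ?_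
      change _ = (S x).shadow r ◃ (S a).shadow r
      rw [hSr, hSr, hSr]
    rw [this, wholeWeight_shadowAct hφ]
  rw [hC, hC']
  have hconn := hX (C.shadow r) (C'.shadow r)
  generalize C.shadow r = a, C'.shadow r = b at hconn
  induction hconn with
  | refl => rfl
  | @tail b b' _ hstep ih =>
    rw [ih]
    obtain ⟨x, rfl | rfl⟩ := hstep
    · rw [act]
    -- An inverse step is a forward step read backwards, from `x ◃⁻¹ b` to `b`.
    · rw [← act x (x ◃⁻¹ b), Rack.right_inv]

end ShadowColouring

/-! ### Counting shadow colourings over arc colourings -/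

/-- The colourings of the arcs of a diagram. -/
def ArcColouring (D : L.Diagram) (X : Type*) [Quandle X] : Type _ :=
  {col : D.Arc → X // ∀ c : D.Crossing, col c.overArc ◃ col c.iniArc = col c.terArc}

theorem bijective_colour_shadow (r : D.Region) : Function.Bijective
    (fun C : D.ShadowColouring X =>
      ((⟨C.colour, C.colour_ter⟩, C.shadow r) : D.ArcColouring X × X)) := by
  refine ⟨fun C C' hCC => ?_, fun ⟨⟨col, hcol⟩, x⟩ => ?_⟩
  · have h1 := congrArg (fun t : D.ArcColouring X × X => t.1.1) hCC
    have h2 := congrArg (fun t : D.ArcColouring X × X => t.2) hCC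
    exact ShadowColouring.eq_of_colour_eq h1 h2
  · obtain ⟨C, rfl, rfl⟩ := ShadowColouring.exists_of_colour col hcol r x
    exact ⟨C, rfl⟩

/-- Idempotence makes the condition on the terminal region automatic, so being allowed only
prescribes the colour of one region. -/
theorem ShadowColouring.isAllowed_iff (C : D.ShadowColouring X) (p : D.SimplePoint) :
    C.IsAllowed p ↔ C.shadow p.iniRegion = C.colour p.arc := by
  refine ⟨fun h => h.1, fun h => ⟨h, ?_⟩⟩
  rw [← C.shadow_ter, h, Quandle.fix]

theorem bijective_colour_allowed (p : D.SimplePoint) : Function.Bijective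
    (fun C : {C : D.ShadowColouring X // C.IsAllowed p} =>
      (⟨C.1.colour, C.1.colour_ter⟩ : D.ArcColouring X)) := by
  refine ⟨fun C C' hCC => ?_, fun ⟨col, hcol⟩ => ?_⟩
  · have h1 : C.1.colour = C'.1.colour := congrArg Subtype.val hCC
    refine Subtype.ext (ShadowColouring.eq_of_colour_eq h1 (r := p.iniRegion) ?_)
    rw [(C.1.isAllowed_iff p).1 C.2, (C'.1.isAllowed_iff p).1 C'.2, h1]
  · obtain ⟨C, rfl, hC⟩ := ShadowColouring.exists_of_colour col hcol p.iniRegion (col p.arc)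
    exact ⟨⟨C, (C.isAllowed_iff p).2 hC⟩, rfl⟩

end Diagram

end OrientedLink

theorem mainTheorem2 {X : Type*} [Quandle X] [Finite X] (hX : QuandleConnected X)
    {A : Type*} [CommGroup A] (φ : (Fin 3 → X) → A) (hφ : IsQuandleCocycle φ)
    (L : OrientedLink) (D : L.Diagram) (p : D.SimplePoint) :
    Finite (D.ShadowColouring X) ∧
      D.shadowInvariant φ = Nat.card X • D.basedShadowInvariant φ p := by
  have : Finite D.Arc := OrientedLink.Diagram.finite_arc
  have hfin : Finite (D.ArcColouring X) := Subtype.finite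
  have hbij := OrientedLink.Diagram.bijective_colour_shadow (X := X) p.iniRegion
  have hbij' := OrientedLink.Diagram.bijective_colour_allowed (X := X) p
  refine ⟨Finite.of_injective _ hbij.1, ?_⟩
  have := Fintype.ofFinite X
  have := Fintype.ofFinite (D.ArcColouring X)
  choose S hS using hbij'.2
  -- The weight of an arc colouring is read off from its allowed shadow colouring; every other
  -- shadow of it has the same weight.
  let w : D.ArcColouring X → MonoidAlgebra ℤ A :=
    fun col => MonoidAlgebra.of ℤ A ((S col).1.wholeWeight φ)
  have hw : ∀ C : D.ShadowColouring X,
      MonoidAlgebra.of ℤ A (C.wholeWeight φ) = w ⟨C.colour, C.colour_ter⟩ := fun C => by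
    simp only [w]
    rw [OrientedLink.Diagram.ShadowColouring.wholeWeight_eq_of_colour_eq hX hφ]
    exact (congrArg Subtype.val (hS ⟨C.colour, C.colour_ter⟩)).symm
  -- The summand ignores the region colour, so the sum over the factor `X` contributes `Nat.card X`.
  have h1 : D.shadowInvariant φ = ∑ᶠ t : D.ArcColouring X × X, w t.1 :=
    finsum_eq_of_bijective _ hbij hw
  have h2 : D.basedShadowInvariant φ p = ∑ᶠ col : D.ArcColouring X, w col :=
    finsum_eq_of_bijective _ hbij' fun C => hw C.1
  rw [h1, h2, finsum_eq_sum_of_fintype, finsum_eq_sum_of_fintype, Fintype.sum_prod_type,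
    Finset.smul_sum]
  simp
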